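/- Let $K$ be a field, let $n\ge 1$, and let $A=N_n^n$ be the path algebra over $K$ of the cyclic quiver $1\to 2\to\cdots\to n\to 1$ modulo the ideal generated by all compositions of $n+1$ consecutive arrows. Write $(i_1\,i_2\cdots i_{l+1})$ for the path starting at $i_1$ and ending at $i_{l+1}$, and multiply paths by concatenation (first path on the left). For a vertex $i$ let $(i)$ be the path of length $0$ at $i$, put $P_i=A(i)$ and ${}_iP=(i)A$, and write $\otimes=\otimes_K$. Let $$\alpha_i: P_i\otimes {}_iP\to A,\qquad x\otimes y\mapsto xy,$$ and let $\beta_i: A\to P_i\otimes{}_iP$ be the homomorphism of $A$-$A$-bimodules with $$\beta_i(1)=\sum_{l=0}^{n} q_l\otimes p_l ,$$ where $p_l$ is the path of length $l$ starting at $i$, and $q_l$ is the path of length $n-l$ which starts at the end of $p_l$ (and hence ends at $i$). Consider the complexes of $A$-$A$-bimodules $$F_i=(0\to P_i\otimes{}_iP\xrightarrow{\ \alpha_i\ }A\to 0),\qquad F_i'=(0\to A\xrightarrow{\ \beta_i\ }P_i\otimes{}_iP\to 0),$$ with $A$ in degree $0$ in both (so $P_i\otimes{}_iP$ is in cohomological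 degree $-1$ in $F_i$ and $1$ in $F_i'$). Two bounded complexes $X,Y$ of $A$-$A$-bimodules (with $K$ acting centrally) are called two-sided tilting complexes inverse to each other if the restrictions of $X$ and of $Y$ to left $A$-modules and to right $A$-modules are perfect (isomorphic in the derived category to bounded complexes of finitely generated projective modules), and $X\otimes_A^{L}Y\simeq A\simeq Y\otimes_A^{L}X$ in the derived category of $A\otimes A^{op}$-modules. The derived Picard group $TrPic(A)$ is the set of isomorphism classes, in this derived category, of the two-sided tilting complexes, with the product induced by $\otimes_A^{L}$. Then for every vertex $i$ the complexes $F_i$ and $F_i'$ are two-sided tilting complexes inverse to each other; in particular their isomorphism classes are elements of $TrPic(A)$. -/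

import Mathlib

open CategoryTheory TensorProduct

universe u

namespace NakayamaTilting

set_option linter.unusedSectionVars false
set_option linter.unusedVariables false

noncomputable section

/-! ### Bimodules over an algebra and their tensor product -/

section Bimodules

variable (K : Type u) [Field K] (A : Type u) [Ring A] [Algebra K A]

/-- The enveloping algebra `A ⊗ Aᵒᵖ`. -/
abbrev Env : Type u := A ⊗[K] Aᵐᵒᵖ

/-- The category of `A`-`A`-bimodules (on which `K` acts centrally). -/
abbrev BimodCat : Type (u + 1) := ModuleCat.{u} (Env K A)

/-- Restriction of a bimodule to a left `A`-module. -/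
abbrev leftRes : BimodCat K A ⥤ ModuleCat.{u} A :=
  ModuleCat.restrictScalars (Algebra.TensorProduct.includeLeft : A →ₐ[K] Env K A).toRingHom

/-- Restriction of a bimodule to a right `A`-module. -/
abbrev rightRes : BimodCat K A ⥤ ModuleCat.{u} Aᵐᵒᵖ :=
  ModuleCat.restrictScalars (Algebra.TensorProduct.includeRight : Aᵐᵒᵖ →ₐ[K] Env K A).toRingHom

/-- The algebra `A`, as an `A`-`A`-bimodule: `(a ⊗ b) • x = a * x * b`. -/
abbrev regularBimod : BimodCat K A :=
  letI : Module (Env K A) A := TensorProduct.Algebra.module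
  ModuleCat.of (Env K A) A

section Outer

variable (M : Type u) [AddCommGroup M] [Module K M] [Module A M] [IsScalarTower K A M]
variable (N : Type u) [AddCommGroup N] [Module K N] [Module Aᵐᵒᵖ N] [IsScalarTower K Aᵐᵒᵖ N]

/-- The tensor product over `K` of a left `A`-module `M` and a right `A`-module `N`, which is an
`A`-`A`-bimodule by `a • (m ⊗ n) • b = (a • m) ⊗ (n • b)`. -/
def Outer (K : Type u) [Field K] (A : Type u) [Ring A] [Algebra K A]
    (M : Type u) [AddCommGroup M] [Module K M] [Module A M] [IsScalarTower K A M]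
    (N : Type u) [AddCommGroup N] [Module K N] [Module Aᵐᵒᵖ N] [IsScalarTower K Aᵐᵒᵖ N] :
    Type u := M ⊗[K] N

instance : AddCommGroup (Outer K A M N) := inferInstanceAs (AddCommGroup (M ⊗[K] N))

/-- The representation of `A ⊗ Aᵒᵖ` on `M ⊗ N`. -/
def outerAction : Env K A →ₐ[K] Module.End K (M ⊗[K] N) :=
  (Module.endTensorEndAlgHom (R := K) (S := K) (A := K) (M := M) (N := N)).comp
    (Algebra.TensorProduct.map (Algebra.lsmul K K M) (Algebra.lsmul K K N))

instance : Module (Env K A) (Outer K A M N) :=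
  Module.compHom (M ⊗[K] N) (outerAction K A M N).toRingHom

variable {M N}

/-- The pure tensor `m ⊗ n`. -/
def Outer.tmul (m : M) (n : N) : Outer K A M N := m ⊗ₜ[K] n

variable {K A}

lemma Outer.smul_tmul (a : A) (b : Aᵐᵒᵖ) (m : M) (n : N) :
    (a ⊗ₜ[K] b : Env K A) • Outer.tmul K A m n = Outer.tmul K A (a • m) (b • n) := rfl

lemma Outer.zero_tmul (n : N) : Outer.tmul K A (0 : M) n = 0 := TensorProduct.zero_tmul _ _

lemma Outer.tmul_zero (m : M) : Outer.tmul K A m (0 : N) = 0 := TensorProduct.tmul_zero _ _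

lemma Outer.induction {p : Outer K A M N → Prop} (h0 : p 0)
    (ht : ∀ m n, p (Outer.tmul K A m n)) (ha : ∀ x y, p x → p y → p (x + y))
    (x : Outer K A M N) : p x :=
  TensorProduct.induction_on (motive := p) x h0 ht ha

variable {M' : Type u} [AddCommGroup M'] [Module K M'] [Module A M'] [IsScalarTower K A M']
variable {N' : Type u} [AddCommGroup N'] [Module K N'] [Module Aᵐᵒᵖ N'] [IsScalarTower K Aᵐᵒᵖ N']

lemma env_linear {V W : Type u} [AddCommGroup V] [AddCommGroup W] [Module (Env K A) V]
    [Module (Env K A) W] (f : V →+ W)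
    (h : ∀ (a : A) (b : Aᵐᵒᵖ) (v : V), f ((a ⊗ₜ[K] b : Env K A) • v) = (a ⊗ₜ[K] b : Env K A) • f v)
    (r : Env K A) (v : V) : f (r • v) = r • f v := by
  induction r using TensorProduct.induction_on with
  | zero =>
    exact (congrArg f (zero_smul (Env K A) v)).trans
      ((map_zero f).trans (zero_smul (Env K A) (f v)).symm)
  | tmul a b => exact h a b v
  | add x y hx hy => rw [add_smul, add_smul, map_add, hx, hy]

/-- The additive map `f ⊗ g`. -/
def Outer.mapAdd (f : M →ₗ[A] M') (g : N →ₗ[Aᵐᵒᵖ] N') : Outer K A M N →+ Outer K A M' N' :=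
  (TensorProduct.map (f.restrictScalars K) (g.restrictScalars K)).toAddMonoidHom

/-- The bimodule morphism `f ⊗ g`. -/
def Outer.map (f : M →ₗ[A] M') (g : N →ₗ[Aᵐᵒᵖ] N') :
    Outer K A M N →ₗ[Env K A] Outer K A M' N' where
  toFun := Outer.mapAdd f g
  map_add' x y := map_add _ x y
  map_smul' := env_linear (Outer.mapAdd f g) (by
      intro a b v
      induction v using Outer.induction with
      | h0 => rw [smul_zero, map_zero, smul_zero]
      | ha x y hx hy => rw [smul_add, map_add, hx, hy, map_add, smul_add]
      | ht m n =>
        rw [Outer.smul_tmul]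
        change Outer.tmul K A (f (a • m)) (g (b • n)) = Outer.tmul K A (a • f m) (b • g n)
        rw [map_smul, map_smul])

lemma Outer.map_tmul (f : M →ₗ[A] M') (g : N →ₗ[Aᵐᵒᵖ] N') (m : M) (n : N) :
    Outer.map (K := K) f g (Outer.tmul K A m n) = Outer.tmul K A (f m) (g n) := rfl

end Outer

section TensorOver

open scoped ModuleCat

variable {K A}

/-- The sub-bimodule of `X ⊗_K Y` generated by the elements `x a ⊗ y - x ⊗ a y`. -/
def balanced (X Y : BimodCat K A) :
    Submodule (Env K A) (Outer K A ((leftRes K A).obj X) ((rightRes K A).obj Y)) :=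
  Submodule.span (Env K A) {t | ∃ (x : X) (a : A) (y : Y),
    t = Outer.tmul K A (M := (leftRes K A).obj X) (N := (rightRes K A).obj Y)
          (((1 : A) ⊗ₜ[K] MulOpposite.op a : Env K A) • x) y
      - Outer.tmul K A (M := (leftRes K A).obj X) (N := (rightRes K A).obj Y)
          x ((a ⊗ₜ[K] (1 : Aᵐᵒᵖ) : Env K A) • y)}

/-- The bimodule `X ⊗_A Y`. -/
abbrev tensorObj (X Y : BimodCat K A) : BimodCat K A :=
  ModuleCat.of (Env K A)
    (Outer K A ((leftRes K A).obj X) ((rightRes K A).obj Y) ⧸ balanced X Y)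

/-- The map induced by `f` and `g` on `X ⊗_K Y`. -/
def outerMap {X X' Y Y' : BimodCat K A} (f : X ⟶ X') (g : Y ⟶ Y') :
    Outer K A ((leftRes K A).obj X) ((rightRes K A).obj Y) →ₗ[Env K A]
      Outer K A ((leftRes K A).obj X') ((rightRes K A).obj Y') :=
  Outer.map ((leftRes K A).map f).hom ((rightRes K A).map g).hom

lemma balanced_le {X X' Y Y' : BimodCat K A} (f : X ⟶ X') (g : Y ⟶ Y') :
    balanced X Y ≤ (balanced X' Y').comap (outerMap f g) := by
  refine Submodule.span_le.2 ?_
  rintro _ ⟨x, a, y, rfl⟩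
  refine Submodule.subset_span ⟨f.hom x, a, g.hom y, ?_⟩
  rw [map_sub, ← map_smul, ← map_smul]
  rfl

/-- The bimodule morphism `f ⊗_A g`. -/
def tensorMap {X X' Y Y' : BimodCat K A} (f : X ⟶ X') (g : Y ⟶ Y') :
    tensorObj X Y ⟶ tensorObj X' Y' :=
  ModuleCat.ofHom (Submodule.mapQ _ _ (outerMap f g) (balanced_le f g))

/-- The class of `x ⊗ y` in `X ⊗_A Y`. -/
def tensorMk {X Y : BimodCat K A} (x : X) (y : Y) : tensorObj X Y :=
  Submodule.Quotient.mk (Outer.tmul K A (M := (leftRes K A).obj X) (N := (rightRes K A).obj Y) x y)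

lemma tensorMap_mk {X X' Y Y' : BimodCat K A} (f : X ⟶ X') (g : Y ⟶ Y') (x : X) (y : Y) :
    (tensorMap f g).hom (tensorMk x y) = tensorMk (f.hom x) (g.hom y) := rfl

lemma tensor_hom_ext {X Y Z : BimodCat K A} {f g : tensorObj X Y ⟶ Z}
    (h : ∀ x y, f.hom (tensorMk x y) = g.hom (tensorMk x y)) : f = g := by
  apply ModuleCat.hom_ext
  apply LinearMap.ext
  intro t
  obtain ⟨t, rfl⟩ := Submodule.Quotient.mk_surjective _ t
  induction t using Outer.induction with
  | h0 => rw [Submodule.Quotient.mk_zero, map_zero, map_zero]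
  | ht x y => exact h x y
  | ha x y hx hy => rw [Submodule.Quotient.mk_add, map_add, map_add, hx, hy]

lemma tensorMk_zero_left {X Y : BimodCat K A} (y : Y) : tensorMk (0 : X) y = 0 := by
  exact (congrArg (Submodule.Quotient.mk (p := balanced X Y)) (Outer.zero_tmul _)).trans
    (Submodule.Quotient.mk_zero _)

lemma tensorMk_zero_right {X Y : BimodCat K A} (x : X) : tensorMk x (0 : Y) = 0 := by
  exact (congrArg (Submodule.Quotient.mk (p := balanced X Y)) (Outer.tmul_zero _)).trans
    (Submodule.Quotient.mk_zero _)

variable (K A)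

/-- The bifunctor `(X, Y) ↦ X ⊗_A Y` on bimodules. -/
def tensorBifunctor : BimodCat K A ⥤ BimodCat K A ⥤ BimodCat K A where
  obj X :=
    { obj := fun Y => tensorObj X Y
      map := fun g => tensorMap (𝟙 X) g
      map_id := fun _ => tensor_hom_ext fun _ _ => rfl
      map_comp := fun _ _ => tensor_hom_ext fun _ _ => rfl }
  map f :=
    { app := fun Y => tensorMap f (𝟙 Y)
      naturality := fun _ _ _ => tensor_hom_ext fun _ _ => rfl }
  map_id X := by
    ext Y : 2
    exact tensor_hom_ext fun x y => rfl
  map_comp f g := by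
    ext Y : 2
    exact tensor_hom_ext fun x y => rfl

instance : (tensorBifunctor K A).PreservesZeroMorphisms where
  map_zero X X' := by
    ext Y : 2
    exact tensor_hom_ext fun x y => tensorMk_zero_left _

instance (X : BimodCat K A) : ((tensorBifunctor K A).obj X).PreservesZeroMorphisms where
  map_zero Y Y' := tensor_hom_ext fun x y => tensorMk_zero_right _

end TensorOver

/-- Cochain complexes of bimodules. -/
abbrev BimodCpx : Type (u + 1) := CochainComplex (BimodCat K A) ℤ

variable {K A} in
/-- The total tensor product `X ⊗_A Y` of two complexes of bimodules. -/
def tensorCpx (X Y : BimodCpx K A) : BimodCpx K A :=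
  HomologicalComplex.mapBifunctor X Y (tensorBifunctor K A) (ComplexShape.up ℤ)

/-! ### Derived categories, perfect complexes, two-sided tilting complexes -/

attribute [local instance] HasDerivedCategory.standard

/-- Two cochain complexes of modules over a ring are isomorphic in the derived category. -/
def DerivedIso {R : Type u} [Ring R] (X Y : CochainComplex (ModuleCat.{u} R) ℤ) : Prop :=
  Nonempty (DerivedCategory.Q.obj X ≅ DerivedCategory.Q.obj Y)

/-- A cochain complex is bounded. -/
def IsBounded {R : Type u} [Ring R] (X : CochainComplex (ModuleCat.{u} R) ℤ) : Prop :=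
  ∃ a b : ℤ, X.IsStrictlyGE a ∧ X.IsStrictlyLE b

/-- A perfect complex: one isomorphic, in the derived category, to a bounded complex of finitely
generated projective modules. -/
def IsPerfect {R : Type u} [Ring R] (X : CochainComplex (ModuleCat.{u} R) ℤ) : Prop :=
  ∃ P : CochainComplex (ModuleCat.{u} R) ℤ, IsBounded P ∧
    (∀ k : ℤ, Module.Finite R (P.X k) ∧ Module.Projective R (P.X k)) ∧ DerivedIso X P

variable {K A}

/-- `X ⊗ᴸ_A Y ≅ Z` in the derived category of bimodules. The derived tensor product is computed
as usual: replace `X` by a quasi-isomorphic bounded above complex `P` of bimodules which are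
projective as right `A`-modules, and form `P ⊗_A Y`. -/
def DerivedTensorIso (X Y Z : BimodCpx K A) : Prop :=
  ∃ (P : BimodCpx K A) (π : P ⟶ X), QuasiIso π ∧ (∃ b : ℤ, P.IsStrictlyLE b) ∧
    (∀ k : ℤ, Module.Projective Aᵐᵒᵖ ((rightRes K A).obj (P.X k))) ∧
    DerivedIso (tensorCpx P Y) Z

variable (K A) in
/-- The bimodule `A`, as a complex concentrated in degree `0`. -/
def unitCpx : BimodCpx K A :=
  (HomologicalComplex.single (BimodCat K A) (ComplexShape.up ℤ) 0).obj (regularBimod K A)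

/-- A bounded complex of bimodules whose restrictions to `A` and to `Aᵒᵖ` are perfect. -/
structure IsBiperfect (X : BimodCpx K A) : Prop where
  bounded : IsBounded X
  left : IsPerfect (((leftRes K A).mapHomologicalComplex (ComplexShape.up ℤ)).obj X)
  right : IsPerfect (((rightRes K A).mapHomologicalComplex (ComplexShape.up ℤ)).obj X)

/-- `X` and `Y` are two-sided tilting complexes inverse to each other. -/
structure AreInverseTilting (X Y : BimodCpx K A) : Prop where
  left : IsBiperfect X
  right : IsBiperfect Y
  tensor_iso : DerivedTensorIso X Y (unitCpx K A)
  tensor_iso' : DerivedTensorIso Y X (unitCpx K A)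

/-- `X` is a two-sided tilting complex. -/
def IsTwoSidedTilting (X : BimodCpx K A) : Prop := ∃ Y : BimodCpx K A, AreInverseTilting X Y

/-- The isomorphism class of a complex of bimodules in the derived category. -/
def isoClass (X : BimodCpx K A) :
    Quotient (isIsomorphicSetoid (DerivedCategory (BimodCat K A))) :=
  Quotient.mk _ (DerivedCategory.Q.obj X)

variable (K A) in
/-- (The underlying set of) the derived Picard group of `A`: the isomorphism classes, in the derived
category of bimodules, of two-sided tilting complexes. -/
def TrPic : Set (Quotient (isIsomorphicSetoid (DerivedCategory (BimodCat K A)))) :=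
  {c | ∃ X : BimodCpx K A, IsTwoSidedTilting X ∧ isoClass X = c}

end Bimodules

/-! ### Path algebras -/

section PathAlgebra

/-- All the paths of a quiver. -/
def AnyPath (V : Type) [Quiver.{0} V] : Type := Σ (a : V) (b : V), Quiver.Path a b

/-- The path algebra `K V` of a quiver with finitely many vertices: the `K`-vector space on the
paths. The product `p * q` of two paths is `p` followed by `q` if `p` ends where `q` starts, and `0`
otherwise. -/
def PathAlgebra (K : Type u) [Field K] (V : Type) [Quiver.{0} V] : Type u := AnyPath V →₀ K

variable (K : Type u) [Field K] (V : Type) [Quiver.{0} V]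

instance : AddCommGroup (PathAlgebra K V) := inferInstanceAs (AddCommGroup (AnyPath V →₀ K))
instance : Module K (PathAlgebra K V) := inferInstanceAs (Module K (AnyPath V →₀ K))

variable {V}

/-- A path, as an element of the path algebra. -/
def PathAlgebra.ofPath {a b : V} (p : Quiver.Path a b) : PathAlgebra K V :=
  Finsupp.single (⟨a, b, p⟩ : AnyPath V) (1 : K)

variable {K}

lemma PathAlgebra.lin_ext {W : Type*} [AddCommGroup W] [Module K W] {f g : PathAlgebra K V →ₗ[K] W}
    (h : ∀ (a b : V) (p : Quiver.Path a b), f (ofPath K p) = g (ofPath K p)) : f = g :=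
  Finsupp.lhom_ext' fun p => LinearMap.ext_ring (h p.1 p.2.1 p.2.2)

lemma PathAlgebra.induction {P : PathAlgebra K V → Prop}
    (zero : P 0) (path : ∀ {a b : V} (p : Quiver.Path a b), P (ofPath K p))
    (add : ∀ x y, P x → P y → P (x + y)) (smul : ∀ (r : K) x, P x → P (r • x))
    (x : PathAlgebra K V) : P x := by
  refine Finsupp.induction_linear (motive := P) x zero add ?_
  intro p r
  have := smul r _ (path p.2.2)
  exact (congrArg P (Finsupp.smul_single_one (p : AnyPath V) r)).mp this

variable [DecidableEq V]

variable (K) in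
/-- The product of two paths. -/
def AnyPath.mul (p q : AnyPath V) : PathAlgebra K V :=
  if h : p.2.1 = q.1 then PathAlgebra.ofPath K (p.2.2.comp (q.2.2.cast h.symm rfl)) else 0

variable (K V) in
/-- The multiplication of the path algebra, as a bilinear map. -/
def PathAlgebra.mulLin : PathAlgebra K V →ₗ[K] PathAlgebra K V →ₗ[K] PathAlgebra K V :=
  Finsupp.lift _ K (AnyPath V) fun p => Finsupp.lift _ K (AnyPath V) fun q => AnyPath.mul K p q

instance : Mul (PathAlgebra K V) := ⟨fun x y => PathAlgebra.mulLin K V x y⟩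

namespace PathAlgebra

lemma mul_def (x y : PathAlgebra K V) : x * y = mulLin K V x y := rfl

lemma ofPath_mul_aux (p q : AnyPath V) :
    ofPath K p.2.2 * ofPath K q.2.2 = AnyPath.mul K p q := by
  have h1 : mulLin K V (ofPath K p.2.2) =
      Finsupp.lift (PathAlgebra K V) K (AnyPath V) fun q => AnyPath.mul K p q := by
    refine (Finsupp.sum_single_index (h := fun p r => r •
      Finsupp.lift (PathAlgebra K V) K (AnyPath V) fun q => AnyPath.mul K p q)
      (zero_smul K _)).trans (one_smul K _)
  rw [mul_def, h1]
  exact (Finsupp.sum_single_index (h := fun q r => r • AnyPath.mul K p q)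
      (zero_smul K _)).trans (one_smul K _)

lemma ofPath_mul_ofPath {a b c : V} (p : Quiver.Path a b) (q : Quiver.Path b c) :
    ofPath K p * ofPath K q = ofPath K (p.comp q) := by
  refine (ofPath_mul_aux ⟨a, b, p⟩ ⟨b, c, q⟩).trans ?_
  simp [AnyPath.mul]

lemma ofPath_mul_ofPath_of_ne {a b c d : V} (p : Quiver.Path a b) (q : Quiver.Path c d)
    (h : b ≠ c) : ofPath K p * ofPath K q = 0 := by
  refine (ofPath_mul_aux ⟨a, b, p⟩ ⟨c, d, q⟩).trans ?_
  simp [AnyPath.mul, h]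

lemma add_mul' (x y z : PathAlgebra K V) : (x + y) * z = x * z + y * z := by
  simp only [mul_def, map_add, LinearMap.add_apply]

lemma mul_add' (x y z : PathAlgebra K V) : x * (y + z) = x * y + x * z := by
  simp only [mul_def, map_add]

lemma smul_mul' (r : K) (x y : PathAlgebra K V) : (r • x) * y = r • (x * y) := by
  simp only [mul_def, map_smul, LinearMap.smul_apply]

lemma mul_smul' (r : K) (x y : PathAlgebra K V) : x * (r • y) = r • (x * y) := by
  simp only [mul_def, map_smul]

lemma zero_mul' (x : PathAlgebra K V) : 0 * x = 0 := by
  simp only [mul_def, map_zero, LinearMap.zero_apply]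

lemma mul_zero' (x : PathAlgebra K V) : x * 0 = 0 := by
  simp only [mul_def, map_zero]

variable [Fintype V]

/-- The unit element is the sum of the paths of length `0`. -/
instance : One (PathAlgebra K V) := ⟨∑ a : V, ofPath K (Quiver.Path.nil : Quiver.Path a a)⟩

lemma one_def : (1 : PathAlgebra K V) = ∑ a : V, ofPath K (Quiver.Path.nil : Quiver.Path a a) := rfl

lemma one_mul' (x : PathAlgebra K V) : 1 * x = x := by
  suffices h : mulLin K V 1 = LinearMap.id from LinearMap.congr_fun h x
  refine lin_ext fun a b p => ?_
  rw [one_def, map_sum, LinearMap.sum_apply, Finset.sum_eq_single a]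
  · rw [← mul_def, ofPath_mul_ofPath, Quiver.Path.nil_comp]; rfl
  · intro c _ hc
    rw [← mul_def, ofPath_mul_ofPath_of_ne _ _ hc]
  · simp

lemma mul_one' (x : PathAlgebra K V) : x * 1 = x := by
  suffices h : (mulLin K V).flip 1 = LinearMap.id from LinearMap.congr_fun h x
  refine lin_ext fun a b p => ?_
  rw [one_def, map_sum, LinearMap.sum_apply, Finset.sum_eq_single b]
  · rw [LinearMap.flip_apply, ← mul_def, ofPath_mul_ofPath, Quiver.Path.comp_nil]; rfl
  · intro c _ hc
    rw [LinearMap.flip_apply, ← mul_def, ofPath_mul_ofPath_of_ne _ _ hc.symm]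
  · simp

lemma mul_assoc' (x y z : PathAlgebra K V) : x * y * z = x * (y * z) := by
  induction x using induction with
  | zero => simp only [zero_mul']
  | add x x' hx hx' => rw [add_mul', add_mul', hx, hx', add_mul']
  | smul r x hx => rw [smul_mul', smul_mul', hx, smul_mul']
  | path p =>
  induction y using induction with
  | zero => simp only [zero_mul', mul_zero']
  | add x x' hx hx' => rw [mul_add', add_mul', hx, hx', add_mul', mul_add']
  | smul r x hx => rw [smul_mul', mul_smul', smul_mul', hx, mul_smul']
  | path q =>
  induction z using induction with
  | zero => simp only [mul_zero']
  | add x x' hx hx' => rw [mul_add', mul_add', hx, hx', mul_add']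
  | smul r x hx => rw [mul_smul', mul_smul', hx, mul_smul']
  | @path c c' s =>
  rename_i a a' b b'
  by_cases h : a' = b
  · subst h
    by_cases h' : b' = c
    · subst h'
      simp only [ofPath_mul_ofPath, Quiver.Path.comp_assoc]
    · rw [ofPath_mul_ofPath, ofPath_mul_ofPath_of_ne _ _ h', ofPath_mul_ofPath_of_ne _ _ h',
        mul_zero']
  · rw [ofPath_mul_ofPath_of_ne _ _ h, zero_mul']
    by_cases h' : b' = c
    · subst h'
      rw [ofPath_mul_ofPath, ofPath_mul_ofPath_of_ne _ _ h]
    · rw [ofPath_mul_ofPath_of_ne _ _ h', mul_zero']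

instance : Ring (PathAlgebra K V) where
  __ := (inferInstance : AddCommGroup (PathAlgebra K V))
  mul_assoc := mul_assoc'
  one_mul := one_mul'
  mul_one := mul_one'
  left_distrib := mul_add'
  right_distrib := add_mul'
  zero_mul := zero_mul'
  mul_zero := mul_zero'

instance : Algebra K (PathAlgebra K V) := Algebra.ofModule smul_mul' mul_smul'

end PathAlgebra
end PathAlgebra

/-! ### The Nakayama algebras -/

section Nakayama

/-- The cyclic quiver `1 → 2 → ⋯ → m → 1`, with the set of vertices `ℤ/m` and exactly one arrow
`j → j + 1` for each vertex `j`. -/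
instance cyclicQuiver (m : ℕ) : Quiver.{0} (ZMod m) where
  Hom a b := PLift (b = a + 1)

/-- The relations of the Nakayama algebra: all paths of length `n + 1` are `0`. -/
inductive NakayamaRel (K : Type u) [Field K] (n m : ℕ) [NeZero m] :
    PathAlgebra K (ZMod m) → PathAlgebra K (ZMod m) → Prop
  | long {a b : ZMod m} (p : Quiver.Path a b) (hp : p.length = n + 1) :
      NakayamaRel K n m (PathAlgebra.ofPath K p) 0

/-- The self-injective Nakayama algebra `N^n_m`: the path algebra of the cyclic quiver with `m`
vertices modulo the ideal generated by all compositions of `n + 1` consecutive arrows. -/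
abbrev Nakayama (K : Type u) [Field K] (n m : ℕ) [NeZero m] : Type u :=
  RingQuot (NakayamaRel K n m)

/-- The path of length `l` starting at `j` in the cyclic quiver. -/
def walk {m : ℕ} (j : ZMod m) : (l : ℕ) → Quiver.Path j (j + (l : ZMod m))
  | 0 => Quiver.Path.nil.cast rfl (by simp)
  | l + 1 => (walk j l).cons ⟨by push_cast; ring⟩

lemma length_walk {m : ℕ} (j : ZMod m) (l : ℕ) : (walk j l).length = l := by
  induction l with
  | zero =>
    have h : ∀ {b : ZMod m} (h : j = b), ((Quiver.Path.nil : Quiver.Path j j).cast rfl h).length = 0 := by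
      rintro b rfl; rfl
    exact h _
  | succ l ih => exact congrArg (· + 1) ih

lemma anyPath_eq_walk {m : ℕ} {a b : ZMod m} (p : Quiver.Path a b) :
    (⟨a, b, p⟩ : AnyPath (ZMod m)) = ⟨a, _, walk a p.length⟩ := by
  induction p with
  | nil =>
    have h : ∀ {b : ZMod m} (h : a = b), (⟨a, a, Quiver.Path.nil⟩ : AnyPath (ZMod m)) =
        ⟨a, b, (Quiver.Path.nil : Quiver.Path a a).cast rfl h⟩ := by
      rintro b rfl; rfl
    exact h _
  | @cons b c p e ih =>
    have key : ∀ (l : ℕ) (b c : ZMod m) (p : Quiver.Path a b) (e : b ⟶ c),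
        (⟨a, b, p⟩ : AnyPath (ZMod m)) = ⟨a, _, walk a l⟩ →
        (⟨a, c, p.cons e⟩ : AnyPath (ZMod m)) = ⟨a, _, walk a (l + 1)⟩ := by
      intro l b c p e h
      have h2 := eq_of_heq (Sigma.mk.inj h).2
      obtain ⟨h3, h4⟩ := Sigma.mk.inj h2
      subst h3
      obtain rfl := eq_of_heq h4
      obtain ⟨e⟩ := e
      have h5 : c = a + ((l + 1 : ℕ) : ZMod m) := by rw [e]; push_cast; ring
      subst h5
      rfl
    exact key _ _ _ _ _ ih

variable (K : Type u) [Field K] (n m : ℕ) [NeZero m]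

/-- The class in `N^n_m` of the path of length `l` starting at `j`. -/
def path (j : ZMod m) (l : ℕ) : Nakayama K n m :=
  RingQuot.mkAlgHom K (NakayamaRel K n m) (PathAlgebra.ofPath K (walk j l))

/-- The idempotent of `N^n_m` given by the path of length `0` at `j`. -/
abbrev idem (j : ZMod m) : Nakayama K n m := path K n m j 0

variable {m}

lemma ofPath_eq_walk {a b : ZMod m} (p : Quiver.Path a b) :
    PathAlgebra.ofPath K p = PathAlgebra.ofPath K (walk a p.length) :=
  congrArg (fun q : AnyPath (ZMod m) => (Finsupp.single q (1 : K) : AnyPath (ZMod m) →₀ K))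
    (anyPath_eq_walk p)

lemma path_mul_path (j j' : ZMod m) (l k : ℕ) (h : j' = j + (l : ZMod m)) :
    path K n m j l * path K n m j' k = path K n m j (l + k) := by
  subst h
  rw [path, path, ← map_mul, PathAlgebra.ofPath_mul_ofPath, ofPath_eq_walk,
    Quiver.Path.length_comp, length_walk, length_walk, path]

lemma path_mul_path_of_ne (j j' : ZMod m) (l k : ℕ) (h : j + (l : ZMod m) ≠ j') :
    path K n m j l * path K n m j' k = 0 := by
  rw [path, path, ← map_mul, PathAlgebra.ofPath_mul_ofPath_of_ne _ _ h, map_zero]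

lemma path_eq_zero (j : ZMod m) (l : ℕ) (h : n < l) : path K n m j l = 0 := by
  obtain ⟨k, rfl⟩ := Nat.exists_eq_add_of_lt h
  have h0 : path K n m j (n + 1) = 0 := by
    rw [path, RingQuot.mkAlgHom_rel K (NakayamaRel.long (walk j (n + 1)) (length_walk _ _)),
      map_zero]
  rw [show n + k + 1 = (n + 1) + k by omega, ← path_mul_path K n j _ (n + 1) k rfl, h0, zero_mul]

lemma nakayama_induction {P : Nakayama K n m → Prop} (zero : P 0)
    (path : ∀ j l, P (path K n m j l)) (add : ∀ x y, P x → P y → P (x + y))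
    (smul : ∀ (r : K) x, P x → P (r • x)) (x : Nakayama K n m) : P x := by
  obtain ⟨x, rfl⟩ := RingQuot.mkAlgHom_surjective K (NakayamaRel K n m) x
  induction x using PathAlgebra.induction with
  | zero => rwa [map_zero]
  | path p => rw [ofPath_eq_walk]; exact path _ _
  | add x y hx hy => rw [map_add]; exact add _ _ hx hy
  | smul r x hx => rw [map_smul]; exact smul _ _ hx

/-- The projective left module `P_i = A (i)`. -/
def leftP (i : ZMod m) : Submodule (Nakayama K n m) (Nakayama K n m) :=
  Submodule.span _ {idem K n m i}

/-- The projective right module `_iP = (i) A`. -/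
def rightP (i : ZMod m) : Submodule (Nakayama K n m)ᵐᵒᵖ (Nakayama K n m) :=
  Submodule.span _ {idem K n m i}

lemma path_mem_leftP (i j : ZMod m) (l : ℕ) (h : j + (l : ZMod m) = i) :
    path K n m j l ∈ leftP K n i :=
  Submodule.mem_span_singleton.2 ⟨path K n m j l, path_mul_path K n j i l 0 h.symm⟩

lemma path_mem_rightP (i : ZMod m) (l : ℕ) : path K n m i l ∈ rightP K n i :=
  Submodule.mem_span_singleton.2 ⟨MulOpposite.op (path K n m i l),
    (path_mul_path K n i i 0 l (by simp)).trans (by rw [zero_add])⟩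

/-- The bimodule `P_i ⊗ _iP`. -/
abbrev PP (i : ZMod m) : BimodCat K (Nakayama K n m) :=
  ModuleCat.of (Env K (Nakayama K n m)) (Outer K (Nakayama K n m) (leftP K n i) (rightP K n i))

/-- The map `x ⊗ y ↦ x y`, as an additive map. -/
def alphaAdd (i : ZMod m) :
    Outer K (Nakayama K n m) (leftP K n i) (rightP K n i) →+ Nakayama K n m :=
  (TensorProduct.lift ((LinearMap.mul K (Nakayama K n m)).compl₁₂
    ((leftP K n i).subtype.restrictScalars K)
    ((rightP K n i).subtype.restrictScalars K))).toAddMonoidHom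

/-- The bimodule morphism `α_i : P_i ⊗ _iP → A`, `x ⊗ y ↦ x y`. -/
def alpha (i : ZMod m) : PP K n i ⟶ regularBimod K (Nakayama K n m) :=
  letI : Module (Env K (Nakayama K n m)) (Nakayama K n m) := TensorProduct.Algebra.module
  ModuleCat.ofHom
    { toFun := alphaAdd K n i
      map_add' := map_add _
      map_smul' := env_linear (alphaAdd K n i) (by
        intro a b v
        induction v using Outer.induction with
        | h0 => rw [smul_zero, map_zero, smul_zero]
        | ha x y hx hy => rw [smul_add, map_add, hx, hy, map_add, smul_add]
        | ht x y =>
          rw [Outer.smul_tmul, TensorProduct.Algebra.smul_def]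
          change (a * (x : Nakayama K n m)) * ((y : Nakayama K n m) * b.unop)
            = a * (((x : Nakayama K n m) * (y : Nakayama K n m)) * b.unop)
          simp only [mul_assoc]) }

lemma alpha_tmul (i : ZMod m) (x : leftP K n i) (y : rightP K n i) :
    (alpha K n i).hom (Outer.tmul K (Nakayama K n m) x y) =
      (x : Nakayama K n m) * (y : Nakayama K n m) := rfl

end Nakayama

section Symmetric

/-! From now on `m = n`. -/

variable (K : Type u) [Field K] {n : ℕ} [NeZero n]

lemma cycle_end (i : ZMod n) (l : Fin (n + 1)) :
    i + ((l : ℕ) : ZMod n) + ((n - (l : ℕ) : ℕ) : ZMod n) = i := by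
  rw [add_assoc, ← Nat.cast_add, Nat.add_sub_cancel' (Nat.lt_succ_iff.1 l.2), ZMod.natCast_self,
    add_zero]

/-- The element `∑ (j ⋯ i) ⊗ (i ⋯ j)` of `P_i ⊗ _iP`, where `(i ⋯ j)` runs over the paths starting
at `i` of length `l = 0, …, n`, and the lengths of `(i ⋯ j)` and `(j ⋯ i)` add up to `n`. -/
def betaOne (i : ZMod n) :
    Outer K (Nakayama K n n) (leftP K n i) (rightP K n i) :=
  ∑ l : Fin (n + 1), Outer.tmul K (Nakayama K n n)
    (⟨path K n n (i + ((l : ℕ) : ZMod n)) (n - l),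
      path_mem_leftP K n i _ _ (cycle_end i l)⟩ : leftP K n i)
    (⟨path K n n i l, path_mem_rightP K n i l⟩ : rightP K n i)

lemma betaOne_central (i : ZMod n) (a : Nakayama K n n) :
    (a ⊗ₜ[K] (1 : (Nakayama K n n)ᵐᵒᵖ) : Env K (Nakayama K n n)) • betaOne K i =
      ((1 : Nakayama K n n) ⊗ₜ[K] MulOpposite.op a : Env K (Nakayama K n n)) • betaOne K i := by
  induction a using nakayama_induction with
  | zero => rw [MulOpposite.op_zero, TensorProduct.zero_tmul, TensorProduct.tmul_zero]
  | add x y hx hy =>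
    rw [MulOpposite.op_add, TensorProduct.add_tmul, TensorProduct.tmul_add, add_smul, add_smul,
      hx, hy]
  | smul r x hx =>
    rw [MulOpposite.op_smul, ← TensorProduct.smul_tmul', TensorProduct.tmul_smul,
      ← smul_one_mul r, mul_smul, hx, ← mul_smul, smul_one_mul]
  | path j k =>
    let A := Nakayama K n n
    -- a total version of the pure tensors
    let T : A → A → Outer K A (leftP K n i) (rightP K n i) := fun x y => Outer.tmul K A
      (⟨x * idem K n n i, Submodule.mem_span_singleton.2 ⟨x, rfl⟩⟩ : leftP K n i)
      (⟨idem K n n i * y, Submodule.mem_span_singleton.2 ⟨MulOpposite.op y, rfl⟩⟩ : rightP K n i)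
    have hT : ∀ (x y : A) (hx : x ∈ leftP K n i) (hy : y ∈ rightP K n i),
        Outer.tmul K A (⟨x, hx⟩ : leftP K n i) (⟨y, hy⟩ : rightP K n i) = T x y := by
      intro x y hx hy
      have hi : idem K n n i * idem K n n i = idem K n n i :=
        path_mul_path K n i i 0 0 (by simp)
      have h1 : x * idem K n n i = x := by
        obtain ⟨z, rfl⟩ := Submodule.mem_span_singleton.1 hx
        rw [smul_eq_mul, mul_assoc, hi]
      have h2 : idem K n n i * y = y := by
        obtain ⟨z, rfl⟩ := Submodule.mem_span_singleton.1 hy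
        rw [MulOpposite.smul_eq_mul_unop, ← mul_assoc, hi]
      simp only [T, h1, h2]
    have hT0 : ∀ y, T 0 y = 0 := fun y => by
      simp only [T, zero_mul]; exact Outer.zero_tmul _
    have hT0' : ∀ x, T x 0 = 0 := fun y => by
      simp only [T, mul_zero]; exact Outer.tmul_zero _
    have hl : (path K n n j k ⊗ₜ[K] (1 : Aᵐᵒᵖ) : Env K A) • betaOne K i =
        ∑ l ∈ Finset.range (n + 1), T (path K n n j k * path K n n (i + (l : ZMod n)) (n - l))
          (path K n n i l) := by
      rw [betaOne, Finset.smul_sum, Finset.sum_range]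
      refine Finset.sum_congr rfl fun l _ => ?_
      rw [Outer.smul_tmul, one_smul]
      exact hT _ _ _ _
    have hr : ((1 : A) ⊗ₜ[K] MulOpposite.op (path K n n j k) : Env K A) • betaOne K i =
        ∑ l ∈ Finset.range (n + 1), T (path K n n (i + (l : ZMod n)) (n - l))
          (path K n n i l * path K n n j k) := by
      rw [betaOne, Finset.smul_sum, Finset.sum_range]
      refine Finset.sum_congr rfl fun l _ => ?_
      rw [Outer.smul_tmul, one_smul]
      exact hT _ _ _ _
    rw [hl, hr]
    by_cases hk : n < k
    · rw [path_eq_zero K n j k hk]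
      simp only [zero_mul, mul_zero, hT0, hT0']
    · have e1 : n + 1 = k + (n + 1 - k) := by omega
      have e2 : n + 1 = (n + 1 - k) + k := by omega
      conv_lhs => rw [e1, Finset.sum_range_add]
      conv_rhs => rw [e2, Finset.sum_range_add]
      rw [Finset.sum_eq_zero (s := Finset.range k), zero_add,
        Finset.sum_eq_zero (s := Finset.range k), add_zero]
      · refine Finset.sum_congr rfl fun l hl => ?_
        rw [Finset.mem_range] at hl
        by_cases h : j = i + (l : ZMod n)
        · subst h
          rw [path_mul_path _ _ _ _ _ _ (by push_cast; ring), path_mul_path _ _ _ _ _ _ rfl]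
          congr 2 <;> omega
        · rw [path_mul_path_of_ne _ _ _ _ _ _ (fun h' => h ?_),
            path_mul_path_of_ne _ _ _ _ _ _ (fun h' => h h'.symm), hT0, hT0']
          push_cast at h'
          linear_combination h'
      · intro l hl
        rw [Finset.mem_range] at hl
        by_cases h : i + ((n + 1 - k + l : ℕ) : ZMod n) = j
        · rw [path_mul_path _ _ _ _ _ _ h.symm, path_eq_zero _ _ _ (n + 1 - k + l + k) (by omega),
            hT0']
        · rw [path_mul_path_of_ne _ _ _ _ _ _ h, hT0']
      · intro l hl
        rw [Finset.mem_range] at hl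
        by_cases h : j + (k : ZMod n) = i + (l : ZMod n)
        · rw [path_mul_path _ _ _ _ _ _ h.symm, path_eq_zero _ _ _ (k + (n - l)) (by omega), hT0]
        · rw [path_mul_path_of_ne _ _ _ _ _ _ h, hT0]

/-- The bimodule morphism `β_i : A → P_i ⊗ _iP` with
`β_i 1 = ∑ (j ⋯ i) ⊗ (i ⋯ j)`. -/
def beta (i : ZMod n) : regularBimod K (Nakayama K n n) ⟶ PP K n i :=
  letI : Module (Env K (Nakayama K n n)) (Nakayama K n n) := TensorProduct.Algebra.module
  ModuleCat.ofHom
    { toFun := fun a => (a ⊗ₜ[K] 1 : Env K (Nakayama K n n)) • betaOne K i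
      map_add' := fun x y => by rw [TensorProduct.add_tmul, add_smul]
      map_smul' := env_linear
        (AddMonoidHom.mk' (fun a : Nakayama K n n =>
          (a ⊗ₜ[K] 1 : Env K (Nakayama K n n)) • betaOne K i)
          (fun x y => by rw [TensorProduct.add_tmul, add_smul])) (by
        intro a b x
        rw [TensorProduct.Algebra.smul_def]
        change ((a * (x * b.unop)) ⊗ₜ[K] 1 : Env K (Nakayama K n n)) • betaOne K i =
          (a ⊗ₜ[K] b : Env K (Nakayama K n n)) •
            (x ⊗ₜ[K] 1 : Env K (Nakayama K n n)) • betaOne K i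
        rw [← mul_smul, Algebra.TensorProduct.tmul_mul_tmul, mul_one, ← mul_assoc,
          show ((a * x * b.unop) ⊗ₜ[K] (1 : (Nakayama K n n)ᵐᵒᵖ) : Env K (Nakayama K n n)) =
            ((a * x) ⊗ₜ[K] 1) * (b.unop ⊗ₜ[K] 1) by
            rw [Algebra.TensorProduct.tmul_mul_tmul, mul_one], mul_smul, betaOne_central,
          ← mul_smul, Algebra.TensorProduct.tmul_mul_tmul, mul_one, one_mul, MulOpposite.op_unop]) }

lemma beta_one (i : ZMod n) : (beta K i).hom (1 : Nakayama K n n) = betaOne K i :=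
  one_smul (Env K (Nakayama K n n)) (betaOne K i)

/-- The complex `F_i = (0 → P_i ⊗ _iP → A → 0)` with differential `α_i` and with `A` in degree `0`
(so that `P_i ⊗ _iP` is in cohomological degree `-1`). -/
def F (i : ZMod n) : BimodCpx K (Nakayama K n n) :=
  HomologicalComplex.double (alpha K n i)
    (show (ComplexShape.up ℤ).Rel (-1) 0 from neg_add_cancel (1 : ℤ))

/-- The complex `F_i' = (0 → A → P_i ⊗ _iP → 0)` with differential `β_i` and with `A` in degree `0`
(so that `P_i ⊗ _iP` is in cohomological degree `1`). -/
def F' (i : ZMod n) : BimodCpx K (Nakayama K n n) :=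
  HomologicalComplex.double (beta K i)
    (show (ComplexShape.up ℤ).Rel 0 1 from zero_add (1 : ℤ))

end Symmetric

end

end NakayamaTilting

/-! Write `Q = P_i ⊗ _iP`. After the identifications `Q ⊗_A A ≅ Q ≅ A ⊗_A Q` and `A ⊗_A A ≅ A`, both
products of `F_i` and `F_i'` become complexes `Q → V ⊞ A → Q` in degrees `-1, 0, 1`, where `V = Q
⊗_A Q = P_i ⊗ (i)A(i) ⊗ _iP`. Every path from `i` to `i` has length divisible by `n`, so `(i)A(i)`
is spanned by the idempotent `(i)` and the cycle of length `n`, and `V` consists of two copies of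
`Q`. Up to sign, the first differential embeds `Q` in `V` as the cycle copy, modulo the idempotent
copy, and the second maps the idempotent copy isomorphically onto `Q`. The two copies of `V` thus
cancel against the outer terms, and `A` remains.

The explicit data are a retraction `contract` of the embedding and a section `insert` of the second
map, with `insert ≫ contract = 0`. The map `contract` uses the linear form `nakayamaForm`, the sum
of the coefficients of the paths of length `n`. The paths `q_l` and `p_l` in `β_i(1)` are dual bases
for this form (`sum_form_smul_path`, `sum_form_smul_path'`), which gives `coactRight_contract` and
`coactLeft_contract`. That the two copies exhaust `V` is `contraction_identity`, which rests on
`corner_eq`. From these data `nonempty_homotopyEquiv_of_square` builds a homotopy equivalence of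
complexes of bimodules with `A`. Linear independence of the paths is never needed: the form, which
visibly descends to the quotient, detects all that has to be nonzero.

The ordinary tensor product computes the derived one because `A` and `Q` are finitely generated
projective on each side; this also yields the perfectness of both restrictions. -/

namespace NakayamaTilting

set_option linter.unusedSectionVars false

noncomputable section

/-! ### Three-term complexes and total complexes of `2 × 2` bicomplexes -/

section ThreeTerm

open Limits

variable {C : Type*} [Category* C] [Preadditive C] [HasZeroObject C]

/-- The contracting homotopy with components `h₀ : T⁰ ⟶ T⁻¹` and `h₁ : T¹ ⟶ T⁰`. -/
def threeTermHomotopyHom (T : CochainComplex C ℤ) (h₀ : T.X 0 ⟶ T.X (-1)) (h₁ : T.X 1 ⟶ T.X 0)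
    (p q : ℤ) : T.X p ⟶ T.X q :=
  if h : p = 0 ∧ q = -1 then (T.XIsoOfEq h.1).hom ≫ h₀ ≫ (T.XIsoOfEq h.2).inv
  else if h : p = 1 ∧ q = 0 then (T.XIsoOfEq h.1).hom ≫ h₁ ≫ (T.XIsoOfEq h.2).inv
  else 0

/-- A complex in degrees `-1, 0, 1` which retracts onto an object `A` in degree `0` by a
deformation is homotopy equivalent to `A`. -/
lemma nonempty_homotopyEquiv_single (T : CochainComplex C ℤ)
    (hT : ∀ k : ℤ, k ≠ -1 → k ≠ 0 → k ≠ 1 → IsZero (T.X k)) {A : C}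
    (i : A ⟶ T.X 0) (p : T.X 0 ⟶ A) (h₀ : T.X 0 ⟶ T.X (-1)) (h₁ : T.X 1 ⟶ T.X 0)
    (hi : i ≫ T.d 0 1 = 0) (hp : T.d (-1) 0 ≫ p = 0) (hip : i ≫ p = 𝟙 A)
    (hd₀ : T.d (-1) 0 ≫ h₀ = 𝟙 _) (hd₁ : h₁ ≫ T.d 0 1 = 𝟙 _)
    (hpi : T.d 0 1 ≫ h₁ + h₀ ≫ T.d (-1) 0 + p ≫ i = 𝟙 _) :
    Nonempty (HomotopyEquiv T ((HomologicalComplex.single C (ComplexShape.up ℤ) 0).obj A)) := by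
  let P : T ⟶ (HomologicalComplex.single C (ComplexShape.up ℤ) 0).obj A :=
    HomologicalComplex.mkHomToSingle p (by
      intro k hk
      obtain rfl : k = -1 := by simp at hk; omega
      exact hp)
  let I : (HomologicalComplex.single C (ComplexShape.up ℤ) 0).obj A ⟶ T :=
    HomologicalComplex.mkHomFromSingle i (by
      intro k hk
      obtain rfl : k = 1 := by simp at hk; omega
      exact hi)
  have hIP : I ≫ P = 𝟙 _ := by
    apply HomologicalComplex.from_single_hom_ext
    simp [I, P, HomologicalComplex.mkHomFromSingle_f, HomologicalComplex.mkHomToSingle_f,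
      reassoc_of% hip]
  have hzero : ∀ k : ℤ, k ≠ 0 →
      IsZero (((HomologicalComplex.single C (ComplexShape.up ℤ) 0).obj A).X k) :=
    fun k hk => HomologicalComplex.isZero_single_obj_X _ _ _ _ hk
  let hom := threeTermHomotopyHom T h₀ h₁
  have hom₀ : hom 0 (-1) = h₀ := by simp [hom, threeTermHomotopyHom]
  have hom₁ : hom 1 0 = h₁ := by simp [hom, threeTermHomotopyHom]
  have hom_zero : ∀ a b : ℤ, ¬ (a = 0 ∧ b = -1) → ¬ (a = 1 ∧ b = 0) → hom a b = 0 := by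
    intro a b h h'
    simp only [hom, threeTermHomotopyHom, dif_neg h, dif_neg h']
  -- The homotopy is built from the identity to `P ≫ I`, so that its components enter with positive
  -- sign, and is then reversed.
  refine ⟨⟨P, I, (Homotopy.symm ⟨hom, ?_, ?_⟩), Homotopy.ofEq hIP⟩⟩
  · intro a b hab
    apply hom_zero
    · rintro ⟨rfl, rfl⟩
      simp at hab
    · rintro ⟨rfl, rfl⟩
      simp at hab
  · intro k
    rw [dNext_eq hom (show (ComplexShape.up ℤ).Rel k (k + 1) from rfl),
      prevD_eq hom (show (ComplexShape.up ℤ).Rel (k - 1) k by simp)]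
    by_cases hk0 : k = 0
    · subst hk0
      have e : (P ≫ I).f 0 = p ≫ i := by
        simp [I, P, HomologicalComplex.mkHomFromSingle_f, HomologicalComplex.mkHomToSingle_f]
      rw [e]
      change 𝟙 _ = T.d 0 1 ≫ hom 1 0 + hom 0 (-1) ≫ T.d (-1) 0 + _
      rw [hom₀, hom₁, hpi]
    · have e : (P ≫ I).f k = 0 := by
        rw [HomologicalComplex.comp_f, (hzero k hk0).eq_of_src (I.f k) 0, comp_zero]
      rw [e]
      by_cases hk1 : k = 1
      · subst hk1
        change 𝟙 _ = _ + hom 1 0 ≫ T.d 0 1 + _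
        rw [hom₁, hd₁, hom_zero (1 + 1) 1 (by omega) (by omega)]
        simp
      by_cases hk2 : k = -1
      · subst hk2
        change 𝟙 _ = T.d (-1) 0 ≫ hom 0 (-1) + _ + _
        rw [hom₀, hd₀, hom_zero (-1) (-1 - 1) (by omega) (by omega)]
        simp
      · exact (hT k hk2 hk0 hk1).eq_of_src _ _

variable [HasBinaryBiproducts C]

/-- The total complex of a square `Q ⟶ V ⊞ A ⟶ Q'` which contracts onto `A`. -/
lemma nonempty_homotopyEquiv_of_square (T : CochainComplex C ℤ)
    (hT : ∀ k : ℤ, k ≠ -1 → k ≠ 0 → k ≠ 1 → IsZero (T.X k)) {A V Q : C}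
    (e₁ : T.X (-1) ≅ Q) (e₂ : T.X 0 ≅ V ⊞ A) (e₃ : T.X 1 ≅ Q)
    (b : Q ⟶ V) (α : Q ⟶ A) (m : V ⟶ Q) (β : A ⟶ Q) (r : V ⟶ Q) (j : Q ⟶ V)
    (hd₀ : T.d (-1) 0 = e₁.hom ≫ biprod.lift b α ≫ e₂.inv)
    (hd₁ : T.d 0 1 = e₂.hom ≫ biprod.desc m β ≫ e₃.inv)
    (hbm : b ≫ m + α ≫ β = 0) (hbr : b ≫ r = 𝟙 Q) (hjm : j ≫ m = 𝟙 Q) (hjr : j ≫ r = 0)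
    (h : (𝟙 V - r ≫ b) ≫ (𝟙 V - m ≫ j) = 0) :
    Nonempty (HomotopyEquiv T ((HomologicalComplex.single C (ComplexShape.up ℤ) 0).obj A)) := by
  -- This is the `V`-`V` entry of the homotopy identity. It is `h` expanded, with `b ≫ m` replaced
  -- by `-(α ≫ β)`.
  have h' : m ≫ j + r ≫ b + r ≫ α ≫ β ≫ j = 𝟙 V := by
    have hαβ : α ≫ β = - (b ≫ m) := eq_neg_of_add_eq_zero_right hbm
    rw [reassoc_of% hαβ]
    simp only [Preadditive.sub_comp, Preadditive.comp_sub, Category.id_comp, Category.comp_id,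
      Category.assoc] at h
    simp only [Preadditive.neg_comp, Preadditive.comp_neg, Category.assoc]
    rw [← sub_eq_zero, ← neg_eq_zero, ← h]
    abel
  -- The inclusion of `A` and the projection to `A` are not chain maps by themselves; the
  -- corrections `-(β ≫ j)` and `-(r ≫ α)` make the compositions with the differentials vanish.
  refine nonempty_homotopyEquiv_single T hT
    (biprod.lift (-(β ≫ j)) (𝟙 A) ≫ e₂.inv) (e₂.hom ≫ biprod.desc (-(r ≫ α)) (𝟙 A))
    (e₂.hom ≫ biprod.desc r 0 ≫ e₁.inv) (e₃.hom ≫ biprod.lift j 0 ≫ e₂.inv) ?_ ?_ ?_ ?_ ?_ ?_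
  · simp [hd₁, reassoc_of% hjm]
  · simp [hd₀, reassoc_of% hbr]
  · simp [reassoc_of% hjr]
  · simp [hd₀, reassoc_of% hbr]
  · simp [hd₁, reassoc_of% hjm]
  · rw [← cancel_epi e₂.inv, ← cancel_mono e₂.hom]
    apply biprod.hom_ext'
    · apply biprod.hom_ext
      · simp [hd₀, hd₁, ← h', add_assoc]
      · simp [hd₀, hd₁]
    · apply biprod.hom_ext
      · simp [hd₀, hd₁]
      · simp [hd₀, hd₁]

end ThreeTerm

/-! ### Total complexes of bicomplexes supported on a square. -/

section Square

open Limits HomologicalComplex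

variable {C : Type*} [Category* C] [Preadditive C]
  (X Y : CochainComplex C ℤ) (G : C ⥤ C ⥤ C) [G.PreservesZeroMorphisms]
  [∀ Z, (G.obj Z).PreservesZeroMorphisms] [HasMapBifunctor X Y G (ComplexShape.up ℤ)]

/-- The projection of the total complex onto a summand. -/
def mapBifunctorProj (p q k : ℤ) :
    (mapBifunctor X Y G (ComplexShape.up ℤ)).X k ⟶ (G.obj (X.X p)).obj (Y.X q) :=
  mapBifunctorDesc fun p' q' _ =>
    if h : p' = p ∧ q' = q then eqToHom (by rw [h.1, h.2]) else 0

lemma ι_mapBifunctorProj (p q k : ℤ) (h : p + q = k) :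
    ιMapBifunctor X Y G (ComplexShape.up ℤ) p q k h ≫ mapBifunctorProj X Y G p q k = 𝟙 _ := by
  simp [mapBifunctorProj]

lemma ι_mapBifunctorProj_of_ne (p q p' q' k : ℤ) (h : p' + q' = k) (hne : p' ≠ p) :
    ιMapBifunctor X Y G (ComplexShape.up ℤ) p' q' k h ≫ mapBifunctorProj X Y G p q k = 0 := by
  simp [mapBifunctorProj, hne]

/-- The sign is the Koszul sign of the first degree. Both neighbouring summands are kept, also when
they lie outside the support of the bicomplex. -/
lemma ι_mapBifunctor_d (p q p' q' k k' : ℤ) (hp : p + 1 = p') (hq : q + 1 = q')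
    (h : p + q = k) (h₁ : p' + q = k') (h₂ : p + q' = k') :
    ιMapBifunctor X Y G (ComplexShape.up ℤ) p q k h ≫
        (mapBifunctor X Y G (ComplexShape.up ℤ)).d k k' =
      (G.map (X.d p p')).app (Y.X q) ≫ ιMapBifunctor X Y G (ComplexShape.up ℤ) p' q k' h₁ +
        p.negOnePow • ((G.obj (X.X p)).map (Y.d q q') ≫
          ιMapBifunctor X Y G (ComplexShape.up ℤ) p q' k' h₂) := by
  rw [mapBifunctor.d_eq, Preadditive.comp_add, mapBifunctor.ι_D₁, mapBifunctor.ι_D₂,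
    mapBifunctor.d₁_eq X Y G (ComplexShape.up ℤ) (show (ComplexShape.up ℤ).Rel p p' from hp)
      q k' h₁,
    mapBifunctor.d₂_eq X Y G (ComplexShape.up ℤ) p
      (show (ComplexShape.up ℤ).Rel q q' from hq) k' h₂]
  simp

variable {X Y}

lemma isZero_bifunctor_obj {M N : C} (h : IsZero M ∨ IsZero N) : IsZero ((G.obj M).obj N) := by
  rw [IsZero.iff_id_eq_zero]
  obtain h | h := h
  · have e : G.map (𝟙 M) = 0 := by rw [h.eq_of_src (𝟙 M) 0, Functor.map_zero]
    simpa using congrArg (fun t => t.app N) e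
  · rw [← CategoryTheory.Functor.map_id, h.eq_of_src (𝟙 N) 0, Functor.map_zero]

variable {a b a' b' : ℤ}

lemma mapBifunctor_hom_ext_of_support
    (hX : ∀ k, k ≠ a → k ≠ a' → IsZero (X.X k)) (hY : ∀ k, k ≠ b → k ≠ b' → IsZero (Y.X k))
    {k : ℤ} {Z : C}
    {f g : (mapBifunctor X Y G (ComplexShape.up ℤ)).X k ⟶ Z}
    (h : ∀ p q (h : p + q = k), p = a ∨ p = a' → q = b ∨ q = b' →
      ιMapBifunctor X Y G (ComplexShape.up ℤ) p q k h ≫ f =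
        ιMapBifunctor X Y G (ComplexShape.up ℤ) p q k h ≫ g) : f = g := by
  apply mapBifunctor.hom_ext
  intro p q hpq
  by_cases hp : p = a ∨ p = a'
  · by_cases hq : q = b ∨ q = b'
    · exact h p q hpq hp hq
    · exact (isZero_bifunctor_obj G (Or.inr (hY q (by tauto) (by tauto)))).eq_of_src _ _
  · exact (isZero_bifunctor_obj G (Or.inl (hX p (by tauto) (by tauto)))).eq_of_src _ _

lemma isZero_mapBifunctor_X (ha : a + 1 = a') (hb : b + 1 = b') (hab : a + b = -1)
    (hX : ∀ k, k ≠ a → k ≠ a' → IsZero (X.X k)) (hY : ∀ k, k ≠ b → k ≠ b' → IsZero (Y.X k))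
    (k : ℤ) (h₁ : k ≠ -1) (h₂ : k ≠ 0) (h₃ : k ≠ 1) :
    IsZero ((mapBifunctor X Y G (ComplexShape.up ℤ)).X k) := by
  rw [IsZero.iff_id_eq_zero]
  refine mapBifunctor_hom_ext_of_support G hX hY fun p q h hp hq => ?_
  -- The four possible values of `p + q` are `-1`, `0`, `0` and `1`.
  omega

variable [HasBinaryBiproducts C]

/-- The total complex of a bicomplex concentrated in a square. -/
lemma exists_mapBifunctor_iso_of_support (ha : a + 1 = a') (hb : b + 1 = b') (hab : a + b = -1)
    (hX : ∀ k, k ≠ a → k ≠ a' → IsZero (X.X k)) (hY : ∀ k, k ≠ b → k ≠ b' → IsZero (Y.X k)) :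
    ∃ (e₁ : (mapBifunctor X Y G (ComplexShape.up ℤ)).X (-1) ≅ (G.obj (X.X a)).obj (Y.X b))
      (e₂ : (mapBifunctor X Y G (ComplexShape.up ℤ)).X 0 ≅
        (G.obj (X.X a)).obj (Y.X b') ⊞ (G.obj (X.X a')).obj (Y.X b))
      (e₃ : (mapBifunctor X Y G (ComplexShape.up ℤ)).X 1 ≅ (G.obj (X.X a')).obj (Y.X b')),
      (mapBifunctor X Y G (ComplexShape.up ℤ)).d (-1) 0 = e₁.hom ≫
        biprod.lift (a.negOnePow • (G.obj (X.X a)).map (Y.d b b'))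
          ((G.map (X.d a a')).app (Y.X b)) ≫ e₂.inv ∧
      (mapBifunctor X Y G (ComplexShape.up ℤ)).d 0 1 = e₂.hom ≫
        biprod.desc ((G.map (X.d a a')).app (Y.X b'))
          (a'.negOnePow • (G.obj (X.X a')).map (Y.d b b')) ≫ e₃.inv := by
  have hne : a ≠ a' := by omega
  have hne' : b ≠ b' := by omega
  have h00 : a + b = -1 := hab
  have h01 : a + b' = 0 := by omega
  have h10 : a' + b = 0 := by omega
  have h11 : a' + b' = 1 := by omega
  let e₁ : (mapBifunctor X Y G (ComplexShape.up ℤ)).X (-1) ≅ (G.obj (X.X a)).obj (Y.X b) :=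
    { hom := mapBifunctorProj X Y G a b (-1)
      inv := ιMapBifunctor X Y G (ComplexShape.up ℤ) a b (-1) h00
      hom_inv_id := by
        refine mapBifunctor_hom_ext_of_support G hX hY fun p q h hp hq => ?_
        obtain rfl : p = a := by omega
        obtain rfl : q = b := by omega
        rw [reassoc_of% ι_mapBifunctorProj X Y G p q (-1) h, Category.comp_id]
      inv_hom_id := ι_mapBifunctorProj X Y G a b (-1) h00 }
  let e₃ : (mapBifunctor X Y G (ComplexShape.up ℤ)).X 1 ≅ (G.obj (X.X a')).obj (Y.X b') :=
    { hom := mapBifunctorProj X Y G a' b' 1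
      inv := ιMapBifunctor X Y G (ComplexShape.up ℤ) a' b' 1 h11
      hom_inv_id := by
        refine mapBifunctor_hom_ext_of_support G hX hY fun p q h hp hq => ?_
        obtain rfl : p = a' := by omega
        obtain rfl : q = b' := by omega
        rw [reassoc_of% ι_mapBifunctorProj X Y G p q 1 h, Category.comp_id]
      inv_hom_id := ι_mapBifunctorProj X Y G a' b' 1 h11 }
  let e₂ : (mapBifunctor X Y G (ComplexShape.up ℤ)).X 0 ≅
        (G.obj (X.X a)).obj (Y.X b') ⊞ (G.obj (X.X a')).obj (Y.X b) :=
    { hom := biprod.lift (mapBifunctorProj X Y G a b' 0) (mapBifunctorProj X Y G a' b 0)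
      inv := biprod.desc (ιMapBifunctor X Y G (ComplexShape.up ℤ) a b' 0 h01)
        (ιMapBifunctor X Y G (ComplexShape.up ℤ) a' b 0 h10)
      hom_inv_id := by
        refine mapBifunctor_hom_ext_of_support G hX hY fun p q h hp hq => ?_
        rw [biprod.lift_desc, Preadditive.comp_add, Category.comp_id]
        obtain rfl | rfl := hp
        · obtain rfl : q = b' := by omega
          rw [reassoc_of% ι_mapBifunctorProj X Y G p q 0 h,
            reassoc_of% ι_mapBifunctorProj_of_ne X Y G a' b p q 0 h hne, zero_comp, add_zero]
        · obtain rfl : q = b := by omega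
          rw [reassoc_of% ι_mapBifunctorProj X Y G p q 0 h,
            reassoc_of% ι_mapBifunctorProj_of_ne X Y G a b' p q 0 h hne.symm, zero_comp, zero_add]
      inv_hom_id := by
        apply biprod.hom_ext' <;> apply biprod.hom_ext
        · simpa using ι_mapBifunctorProj X Y G a b' 0 h01
        · simpa using ι_mapBifunctorProj_of_ne X Y G a' b a b' 0 h01 hne
        · simpa using ι_mapBifunctorProj_of_ne X Y G a b' a' b 0 h10 hne.symm
        · simpa using ι_mapBifunctorProj X Y G a' b 0 h10 }
  refine ⟨e₁, e₂, e₃, ?_, ?_⟩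
  · refine (Iso.inv_comp_eq e₁).1 ?_
    rw [biprod.lift_desc]
    refine (ι_mapBifunctor_d X Y G a b a' b' (-1) 0 ha hb h00 h10 h01).trans ?_
    rw [add_comm, Linear.units_smul_comp]
  -- On each of the two summands in degree `0` one of the two terms of the differential leaves the
  -- square; `hd` and `hd'` make it vanish.
  · have hd : ∀ q : ℤ, q ≠ b → (G.obj (X.X a)).map (Y.d b' q) = 0 := by
      intro q hq
      by_cases h : q = b'
      · subst h; simp
      · rw [(hY q hq h).eq_of_tgt (Y.d b' q) 0, Functor.map_zero]
    have hd' : ∀ p : ℤ, p ≠ a → (G.map (X.d a' p)) = 0 := by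
      intro q hq
      by_cases h : q = a'
      · subst h; simp
      · rw [(hX q hq h).eq_of_tgt (X.d a' q) 0, Functor.map_zero]
    refine (Iso.inv_comp_eq e₂).1 ?_
    apply biprod.hom_ext'
    · rw [biprod.inl_desc_assoc, biprod.inl_desc_assoc]
      refine (ι_mapBifunctor_d X Y G a b' a' (b' + 1) 0 1 ha rfl h01 h11 (by omega)).trans ?_
      rw [hd _ (by omega), zero_comp, smul_zero, add_zero]
    · rw [biprod.inr_desc_assoc, biprod.inr_desc_assoc]
      refine (ι_mapBifunctor_d X Y G a' b (a' + 1) b' 0 1 rfl hb h10 (by omega) h11).trans ?_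
      rw [hd' _ (by omega), zero_app, zero_comp, zero_add, Linear.units_smul_comp]

end Square

/-! ### The square obtained from two two-term complexes. -/

section Double

open Limits HomologicalComplex

variable {C : Type*} [Category* C] [Preadditive C] [HasZeroObject C] [HasBinaryBiproducts C]
  {X₀ X₁ Y₀ Y₁ : C} (f : X₀ ⟶ X₁) (g : Y₀ ⟶ Y₁)
  (G : C ⥤ C ⥤ C) [G.PreservesZeroMorphisms] [∀ Z, (G.obj Z).PreservesZeroMorphisms]
  {a b a' b' : ℤ} (ha : (ComplexShape.up ℤ).Rel a a') (hb : (ComplexShape.up ℤ).Rel b b')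
  [HasMapBifunctor (double f ha) (double g hb) G (ComplexShape.up ℤ)]

/-- The total complex obtained from two complexes with two terms. -/
lemma exists_mapBifunctor_double_iso (hab : a + b = -1) :
    ∃ (e₁ : (mapBifunctor (double f ha) (double g hb) G (ComplexShape.up ℤ)).X (-1) ≅
        (G.obj X₀).obj Y₀)
      (e₂ : (mapBifunctor (double f ha) (double g hb) G (ComplexShape.up ℤ)).X 0 ≅
        (G.obj X₀).obj Y₁ ⊞ (G.obj X₁).obj Y₀)
      (e₃ : (mapBifunctor (double f ha) (double g hb) G (ComplexShape.up ℤ)).X 1 ≅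
        (G.obj X₁).obj Y₁),
      (mapBifunctor (double f ha) (double g hb) G (ComplexShape.up ℤ)).d (-1) 0 = e₁.hom ≫
        biprod.lift (a.negOnePow • (G.obj X₀).map g) ((G.map f).app Y₀) ≫ e₂.inv ∧
      (mapBifunctor (double f ha) (double g hb) G (ComplexShape.up ℤ)).d 0 1 = e₂.hom ≫
        biprod.desc ((G.map f).app Y₁) (a'.negOnePow • (G.obj X₁).map g) ≫ e₃.inv := by
  have hne : a ≠ a' := by have : a + 1 = a' := ha; omega
  have hne' : b ≠ b' := by have : b + 1 = b' := hb; omega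
  obtain ⟨e₁, e₂, e₃, h₁, h₂⟩ := exists_mapBifunctor_iso_of_support (X := double f ha)
    (Y := double g hb) G ha hb hab (fun k => isZero_double_X f ha k)
    (fun k => isZero_double_X g hb k)
  let x₀ := doubleXIso₀ f ha
  let x₁ := doubleXIso₁ f ha hne
  let y₀ := doubleXIso₀ g hb
  let y₁ := doubleXIso₁ g hb hne'
  refine ⟨e₁ ≪≫ (G.mapIso x₀).app _ ≪≫ (G.obj X₀).mapIso y₀,
    e₂ ≪≫ biprod.mapIso ((G.mapIso x₀).app _ ≪≫ (G.obj X₀).mapIso y₁)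
      ((G.mapIso x₁).app _ ≪≫ (G.obj X₁).mapIso y₀),
    e₃ ≪≫ (G.mapIso x₁).app _ ≪≫ (G.obj X₁).mapIso y₁, ?_, ?_⟩
  · have key : biprod.lift (a.negOnePow • (G.obj ((double f ha).X a)).map ((double g hb).d b b'))
        ((G.map ((double f ha).d a a')).app ((double g hb).X b)) =
        ((G.mapIso x₀).app _ ≪≫ (G.obj X₀).mapIso y₀).hom ≫
          biprod.lift (a.negOnePow • (G.obj X₀).map g) ((G.map f).app Y₀) ≫
          (biprod.mapIso ((G.mapIso x₀).app _ ≪≫ (G.obj X₀).mapIso y₁)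
            ((G.mapIso x₁).app _ ≪≫ (G.obj X₁).mapIso y₀)).inv := by
      rw [← Category.assoc, Iso.eq_comp_inv, double_d f ha hne, double_d g hb hne']
      apply biprod.hom_ext
      · simp [x₀, x₁, y₀, y₁, Linear.units_smul_comp, Linear.comp_units_smul]
      · simp [x₀, x₁, y₀, y₁]
    rw [h₁, key]
    simp only [Iso.trans_hom, Iso.trans_inv, Category.assoc]
  · have key : biprod.desc ((G.map ((double f ha).d a a')).app ((double g hb).X b'))
        (a'.negOnePow • (G.obj ((double f ha).X a')).map ((double g hb).d b b')) =
        (biprod.mapIso ((G.mapIso x₀).app _ ≪≫ (G.obj X₀).mapIso y₁)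
            ((G.mapIso x₁).app _ ≪≫ (G.obj X₁).mapIso y₀)).hom ≫
          biprod.desc ((G.map f).app Y₁) (a'.negOnePow • (G.obj X₁).map g) ≫
          ((G.mapIso x₁).app _ ≪≫ (G.obj X₁).mapIso y₁).inv := by
      rw [← Category.assoc, Iso.eq_comp_inv, double_d f ha hne, double_d g hb hne']
      apply biprod.hom_ext'
      · simp [x₀, x₁, y₀, y₁]
      · simp [x₀, x₁, y₀, y₁, Linear.units_smul_comp, Linear.comp_units_smul]
    rw [h₂, key]
    simp only [Iso.trans_hom, Iso.trans_inv, Category.assoc]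

end Double

/-! ### Morphisms out of tensor products of bimodules -/

section TensorLift

open scoped ModuleCat

variable {K : Type u} [Field K] {A : Type u} [Ring A] [Algebra K A]

lemma tensorMk_add_left {X Y : BimodCat K A} (x x' : X) (y : Y) :
    tensorMk (x + x') y = tensorMk x y + tensorMk x' y := by
  exact (congrArg (Submodule.Quotient.mk (p := balanced X Y)) (TensorProduct.add_tmul
    (M := (leftRes K A).obj X) (N := (rightRes K A).obj Y) (R := K) x x' y)).trans
    (Submodule.Quotient.mk_add _)

lemma tensorMk_add_right {X Y : BimodCat K A} (x : X) (y y' : Y) :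
    tensorMk x (y + y') = tensorMk x y + tensorMk x y' := by
  exact (congrArg (Submodule.Quotient.mk (p := balanced X Y)) (TensorProduct.tmul_add
    (M := (leftRes K A).obj X) (N := (rightRes K A).obj Y) (R := K) x y y')).trans
    (Submodule.Quotient.mk_add _)

lemma tensorMk_sum_left {X Y : BimodCat K A} {ι : Type*} (s : Finset ι) (f : ι → X) (y : Y) :
    tensorMk (∑ l ∈ s, f l) y = ∑ l ∈ s, tensorMk (f l) y :=
  map_sum (AddMonoidHom.mk' (fun x => tensorMk x y) fun x x' => tensorMk_add_left x x' y) f s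

lemma tensorMk_sum_right {X Y : BimodCat K A} {ι : Type*} (s : Finset ι) (x : X) (f : ι → Y) :
    tensorMk x (∑ l ∈ s, f l) = ∑ l ∈ s, tensorMk x (f l) :=
  map_sum (AddMonoidHom.mk' (fun y => tensorMk x y) fun y y' => tensorMk_add_right x y y') f s

lemma tensorMk_balanced {X Y : BimodCat K A} (x : X) (a : A) (y : Y) :
    tensorMk (((1 : A) ⊗ₜ[K] MulOpposite.op a : Env K A) • x) y =
      tensorMk x ((a ⊗ₜ[K] (1 : Aᵐᵒᵖ) : Env K A) • y) :=
  (Submodule.Quotient.eq (balanced X Y)).2 (Submodule.subset_span ⟨x, a, y, rfl⟩)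

lemma tensor_induction {X Y : BimodCat K A} {p : tensorObj X Y → Prop} (zero : p 0)
    (mk : ∀ x y, p (tensorMk x y)) (add : ∀ s t, p s → p t → p (s + t)) (t : tensorObj X Y) :
    p t := by
  obtain ⟨t, rfl⟩ := Submodule.Quotient.mk_surjective _ t
  induction t using Outer.induction with
  | h0 => exact zero
  | ht x y => exact mk x y
  | ha x y hx hy => exact add _ _ hx hy

lemma algebraMap_tmul_one (k : K) : (algebraMap K A k ⊗ₜ[K] (1 : Aᵐᵒᵖ) : Env K A) =
    (1 : A) ⊗ₜ[K] MulOpposite.op (algebraMap K A k) := by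
  rw [Algebra.algebraMap_eq_smul_one, MulOpposite.op_smul, MulOpposite.op_one,
    TensorProduct.tmul_smul, TensorProduct.smul_tmul']

section

variable {M : Type u} [AddCommGroup M] [Module K M] [Module A M] [IsScalarTower K A M]
  {N : Type u} [AddCommGroup N] [Module K N] [Module Aᵐᵒᵖ N] [IsScalarTower K Aᵐᵒᵖ N]
  {Z : Type u} [AddCommGroup Z] [Module (Env K A) Z] (f : M →+ N →+ Z)
  (hbal : ∀ (k : K) (x : M) (y : N), f (k • x) y = f x (k • y))
  (hlin : ∀ (a : A) (b : Aᵐᵒᵖ) (x : M) (y : N),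
    f (a • x) (b • y) = (a ⊗ₜ[K] b : Env K A) • f x y)

/-- The additive map on `M ⊗_K N` given by a biadditive balanced map. -/
def Outer.liftAdd : Outer K A M N →+ Z :=
  TensorProduct.liftAddHom (R := K) (M := M) (N := N) (P := Z) f hbal

/-- The bimodule morphism on `M ⊗_K N` given by a biadditive balanced equivariant map. -/
def Outer.lift : Outer K A M N →ₗ[Env K A] Z where
  toFun := Outer.liftAdd f hbal
  map_add' := map_add _
  map_smul' := env_linear (Outer.liftAdd f hbal) (by
    intro a b v
    induction v using Outer.induction with
    | h0 => rw [smul_zero, map_zero, smul_zero]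
    | ha x y hx hy => rw [smul_add, map_add, hx, hy, map_add, smul_add]
    | ht x y => exact hlin a b x y)

end

section

variable {X Y Z : BimodCat K A} (f : X →+ Y →+ Z)
  (hbal : ∀ (x : X) (a : A) (y : Y), f (((1 : A) ⊗ₜ[K] MulOpposite.op a : Env K A) • x) y =
    f x ((a ⊗ₜ[K] (1 : Aᵐᵒᵖ) : Env K A) • y))
  (hlin : ∀ (a : A) (b : Aᵐᵒᵖ) (x : X) (y : Y),
    f ((a ⊗ₜ[K] (1 : Aᵐᵒᵖ) : Env K A) • x) (((1 : A) ⊗ₜ[K] b : Env K A) • y) =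
      (a ⊗ₜ[K] b : Env K A) • f x y)

/-- The bimodule morphism on `X ⊗_K Y` given by a biadditive balanced equivariant map. -/
def outerLift : Outer K A ((leftRes K A).obj X) ((rightRes K A).obj Y) →ₗ[Env K A] Z :=
  Outer.lift (M := (leftRes K A).obj X) (N := (rightRes K A).obj Y) f (by
    intro k x y
    -- `K` acts on the left restriction of `X` through `A ⊗ 1` and on the right restriction of `Y`
    -- through `1 ⊗ Aᵒᵖ`, while `hbal` uses the opposite factors. Centrality of `K`
    -- (`algebraMap_tmul_one`) exchanges them on each side.
    have h := hbal x (algebraMap K A k) y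
    rw [← algebraMap_tmul_one k] at h
    conv_rhs at h => rw [algebraMap_tmul_one k]
    exact h) hlin

/-- The morphism `X ⊗_A Y ⟶ Z` given by a biadditive balanced equivariant map. -/
def tensorLift : tensorObj X Y ⟶ Z :=
  ModuleCat.ofHom (Submodule.liftQ _ (outerLift f hbal hlin) (Submodule.span_le.2 (by
    rintro _ ⟨x, a, y, rfl⟩
    change outerLift f hbal hlin _ = 0
    rw [map_sub, sub_eq_zero]
    exact hbal x a y)))

end

/-- The action of an element of `A ⊗ Aᵒᵖ`, as an additive map in both variables. -/
def envSMul (X : BimodCat K A) : Env K A →+ X →+ X :=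
  AddMonoidHom.mk' (fun r => AddMonoidHom.mk' (fun x => r • x) (smul_add r))
    (fun r s => by ext x; exact add_smul r s x)

/-- The unit isomorphism `A ⊗_A X ≅ X`. -/
def tensorLeftUnit (X : BimodCat K A) : tensorObj (regularBimod K A) X ≅ X where
  hom := tensorLift
    ((envSMul X).comp (AddMonoidHom.mk' (fun a : A => (a ⊗ₜ[K] (1 : Aᵐᵒᵖ) : Env K A))
      (fun a b => TensorProduct.add_tmul a b 1)))
    (by
      intro a b x
      -- On the regular bimodule `a ⊗ b` acts by `x ↦ a * (x * b)`, whence the stray factors `1`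
      -- here and below.
      change ((1 * (a * b) : A) ⊗ₜ[K] (1 : Aᵐᵒᵖ) : Env K A) • x =
        (a ⊗ₜ[K] (1 : Aᵐᵒᵖ) : Env K A) • (b ⊗ₜ[K] (1 : Aᵐᵒᵖ) : Env K A) • x
      rw [← mul_smul, Algebra.TensorProduct.tmul_mul_tmul, one_mul, mul_one])
    (by
      intro a b c x
      change ((a * (c * 1) : A) ⊗ₜ[K] (1 : Aᵐᵒᵖ) : Env K A) • ((1 : A) ⊗ₜ[K] b : Env K A) • x =
        (a ⊗ₜ[K] b : Env K A) • (c ⊗ₜ[K] (1 : Aᵐᵒᵖ) : Env K A) • x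
      rw [← mul_smul, ← mul_smul, Algebra.TensorProduct.tmul_mul_tmul,
        Algebra.TensorProduct.tmul_mul_tmul]
      simp only [one_mul, mul_one])
  inv := ModuleCat.ofHom
    { toFun := fun x => tensorMk (X := regularBimod K A) (1 : A) x
      map_add' := fun x y => tensorMk_add_right _ _ _
      map_smul' := env_linear (AddMonoidHom.mk'
        (fun x => tensorMk (X := regularBimod K A) (Y := X) (1 : A) x)
        (fun x y => tensorMk_add_right _ _ _)) (by
          intro a b x
          change tensorMk (X := regularBimod K A) (1 : A) ((a ⊗ₜ[K] b : Env K A) • x) =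
            tensorMk (X := regularBimod K A) (a * (1 * 1) : A) (((1 : A) ⊗ₜ[K] b : Env K A) • x)
          -- The left action on `x` is carried across `⊗_A` to the unit `1`, where left and right
          -- multiplication by `a` agree.
          have h := tensorMk_balanced (X := regularBimod K A) (1 : A) a
            (((1 : A) ⊗ₜ[K] b : Env K A) • x)
          rw [← mul_smul, Algebra.TensorProduct.tmul_mul_tmul, mul_one, one_mul] at h
          rw [← h]
          change tensorMk (X := regularBimod K A) (1 * (1 * a) : A) _ = _
          simp only [one_mul, mul_one]) }
  hom_inv_id := tensor_hom_ext (by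
    intro a x
    change tensorMk (X := regularBimod K A) (1 : A) ((a ⊗ₜ[K] (1 : Aᵐᵒᵖ) : Env K A) • x) =
      tensorMk a x
    rw [← tensorMk_balanced]
    change tensorMk (X := regularBimod K A) (1 * (1 * a) : A) x = _
    simp only [one_mul])
  inv_hom_id := by
    ext x
    exact one_smul (Env K A) x

/-- The unit isomorphism `X ⊗_A A ≅ X`. -/
def tensorRightUnit (X : BimodCat K A) : tensorObj X (regularBimod K A) ≅ X where
  hom := tensorLift
    (AddMonoidHom.flip ((envSMul X).comp
      (AddMonoidHom.mk' (fun a : A => ((1 : A) ⊗ₜ[K] MulOpposite.op a : Env K A))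
      (fun a b => TensorProduct.tmul_add 1 (MulOpposite.op a) (MulOpposite.op b)))))
    (by
      intro x a b
      change ((1 : A) ⊗ₜ[K] MulOpposite.op b : Env K A) •
          ((1 : A) ⊗ₜ[K] MulOpposite.op a : Env K A) • x =
        ((1 : A) ⊗ₜ[K] MulOpposite.op (a * (b * 1)) : Env K A) • x
      rw [← mul_smul, Algebra.TensorProduct.tmul_mul_tmul, one_mul, mul_one, MulOpposite.op_mul])
    (by
      intro a b x c
      change ((1 : A) ⊗ₜ[K] MulOpposite.op (1 * (c * b.unop)) : Env K A) •
          (a ⊗ₜ[K] (1 : Aᵐᵒᵖ) : Env K A) • x =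
        (a ⊗ₜ[K] b : Env K A) • ((1 : A) ⊗ₜ[K] MulOpposite.op c : Env K A) • x
      rw [← mul_smul, ← mul_smul, Algebra.TensorProduct.tmul_mul_tmul,
        Algebra.TensorProduct.tmul_mul_tmul]
      simp only [one_mul, mul_one, MulOpposite.op_mul, MulOpposite.op_unop])
  inv := ModuleCat.ofHom
    { toFun := fun x => tensorMk (Y := regularBimod K A) x (1 : A)
      map_add' := fun x y => tensorMk_add_left _ _ _
      map_smul' := env_linear (AddMonoidHom.mk'
        (fun x => tensorMk (X := X) (Y := regularBimod K A) x (1 : A))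
        (fun x y => tensorMk_add_left _ _ _)) (by
          intro a b x
          change tensorMk (Y := regularBimod K A) ((a ⊗ₜ[K] b : Env K A) • x) (1 : A) =
            tensorMk (Y := regularBimod K A) ((a ⊗ₜ[K] (1 : Aᵐᵒᵖ) : Env K A) • x)
              (1 * (1 * b.unop) : A)
          have h := tensorMk_balanced (Y := regularBimod K A)
            ((a ⊗ₜ[K] (1 : Aᵐᵒᵖ) : Env K A) • x) b.unop (1 : A)
          rw [← mul_smul, Algebra.TensorProduct.tmul_mul_tmul, mul_one, one_mul,
            MulOpposite.op_unop] at h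
          rw [h]
          change tensorMk (Y := regularBimod K A) _ (b.unop * (1 * 1) : A) = _
          simp only [one_mul, mul_one]) }
  hom_inv_id := tensor_hom_ext (by
    intro x a
    change tensorMk (Y := regularBimod K A) (((1 : A) ⊗ₜ[K] MulOpposite.op a : Env K A) • x)
      (1 : A) = tensorMk x a
    rw [tensorMk_balanced]
    change tensorMk (Y := regularBimod K A) x (a * (1 * 1) : A) = _
    simp only [mul_one])
  inv_hom_id := by
    ext x
    exact one_smul (Env K A) x

lemma tensorLeftUnit_naturality {X Y : BimodCat K A} (f : X ⟶ Y) :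
    tensorMap (𝟙 (regularBimod K A)) f ≫ (tensorLeftUnit Y).hom = (tensorLeftUnit X).hom ≫ f :=
  tensor_hom_ext fun a x => (map_smul f.hom (a ⊗ₜ[K] (1 : Aᵐᵒᵖ) : Env K A) x).symm

lemma tensorRightUnit_naturality {X Y : BimodCat K A} (f : X ⟶ Y) :
    tensorMap f (𝟙 (regularBimod K A)) ≫ (tensorRightUnit Y).hom = (tensorRightUnit X).hom ≫ f :=
  tensor_hom_ext fun x a => (map_smul f.hom ((1 : A) ⊗ₜ[K] MulOpposite.op a : Env K A) x).symm

-- Both maps are multiplication. This allows passing between the left and right unit isomorphisms at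
-- `A`, where naturality of one meets naturality of the other.
variable (K A) in
lemma tensorLeftUnit_eq_tensorRightUnit :
    (tensorLeftUnit (regularBimod K A)).hom = (tensorRightUnit (regularBimod K A)).hom :=
  tensor_hom_ext fun a b => by
    change (a * (b * 1) : A) = (1 * (a * b) : A)
    rw [one_mul, mul_one]

end TensorLift

/-! ### The symmetrizing form -/

section Form

variable (K : Type u) [Field K] (n m : ℕ) [NeZero m]

/-- The sum of the coefficients of the paths of length `n`. -/
def pathForm : PathAlgebra K (ZMod m) →ₗ[K] K :=
  Finsupp.lift K K (AnyPath (ZMod m)) fun p => if p.2.2.length = n then 1 else 0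

variable {m}

lemma pathForm_ofPath {a b : ZMod m} (p : Quiver.Path a b) :
    pathForm K n m (PathAlgebra.ofPath K p) = if p.length = n then 1 else 0 :=
  (Finsupp.sum_single_index (a := (⟨a, b, p⟩ : AnyPath (ZMod m))) (b := (1 : K))
    (h := fun q r => r • (if q.2.2.length = n then (1 : K) else 0))
    (zero_smul K _)).trans (one_smul K _)

/-- A product of paths with a factor of length `n + 1` is zero or a path of length greater than `n`,
which the form does not see. -/
lemma pathForm_mul_mul {a b : ZMod m} (p : Quiver.Path a b) (hp : p.length = n + 1)
    (x y : PathAlgebra K (ZMod m)) :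
    pathForm K n m (x * PathAlgebra.ofPath K p * y) = 0 := by
  induction x using PathAlgebra.induction with
  | zero => rw [zero_mul, zero_mul, map_zero]
  | add x x' hx hx' => rw [add_mul, add_mul, map_add, hx, hx', add_zero]
  | smul r x hx => rw [smul_mul_assoc, smul_mul_assoc, map_smul, hx, smul_zero]
  | @path c c' q =>
  by_cases h : c' = a
  · subst h
    rw [PathAlgebra.ofPath_mul_ofPath]
    induction y using PathAlgebra.induction with
    | zero => rw [mul_zero, map_zero]
    | add x x' hx hx' => rw [mul_add, map_add, hx, hx', add_zero]
    | smul r x hx => rw [mul_smul_comm, map_smul, hx, smul_zero]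
    | @path d d' s =>
    by_cases h' : b = d
    · subst h'
      rw [PathAlgebra.ofPath_mul_ofPath, pathForm_ofPath, if_neg]
      rw [Quiver.Path.length_comp, Quiver.Path.length_comp]
      omega
    · rw [PathAlgebra.ofPath_mul_ofPath_of_ne _ _ h', map_zero]
  · rw [PathAlgebra.ofPath_mul_ofPath_of_ne _ _ h, zero_mul, map_zero]

/-- The relation is closed under multiplication on both sides; carrying arbitrary factors `u` and
`v` through the induction absorbs these closure steps. The case `u = v = 1` makes the form descend
to the quotient. -/
lemma pathForm_eq_of_rel {x y : PathAlgebra K (ZMod m)}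
    (h : RingQuot.Rel (NakayamaRel K n m) x y) (u v : PathAlgebra K (ZMod m)) :
    pathForm K n m (u * x * v) = pathForm K n m (u * y * v) := by
  induction h generalizing u v with
  | of h =>
    obtain ⟨p, hp⟩ := h
    rw [pathForm_mul_mul K n p hp, mul_zero, zero_mul, map_zero]
  | add_left _ ih => simp only [mul_add, add_mul, map_add, ih]
  | mul_left _ ih => simpa only [mul_assoc] using ih u (_ * v)
  | mul_right _ ih => simpa only [mul_assoc] using ih (u * _) v

/-- The function on `N^n_m` induced by `pathForm`. -/
def nakayamaFormFun (x : Nakayama K n m) : K :=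
  Quot.lift (pathForm K n m)
    (fun x y h => by simpa only [one_mul, mul_one] using pathForm_eq_of_rel K n h 1 1) x.toQuot

lemma nakayamaFormFun_mk (x : PathAlgebra K (ZMod m)) :
    nakayamaFormFun K n (RingQuot.mkAlgHom K (NakayamaRel K n m) x) = pathForm K n m x := by
  simp only [RingQuot.mkAlgHom_def, RingQuot.mkRingHom_def]
  rfl

variable (m) in
/-- The linear form on `N^n_m` which sums the coefficients of the paths of length `n`. -/
def nakayamaForm : Nakayama K n m →ₗ[K] K where
  toFun := nakayamaFormFun K n
  map_add' x y := by
    obtain ⟨x, rfl⟩ := RingQuot.mkAlgHom_surjective K (NakayamaRel K n m) x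
    obtain ⟨y, rfl⟩ := RingQuot.mkAlgHom_surjective K (NakayamaRel K n m) y
    rw [← map_add, nakayamaFormFun_mk, nakayamaFormFun_mk, nakayamaFormFun_mk, map_add]
  map_smul' r x := by
    obtain ⟨x, rfl⟩ := RingQuot.mkAlgHom_surjective K (NakayamaRel K n m) x
    rw [← map_smul, nakayamaFormFun_mk, nakayamaFormFun_mk, map_smul, RingHom.id_apply]

lemma nakayamaForm_path (j : ZMod m) (l : ℕ) :
    nakayamaForm K n m (path K n m j l) = if l = n then 1 else 0 := by
  refine (nakayamaFormFun_mk K n _).trans ?_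
  rw [pathForm_ofPath, length_walk]

/-- Paths of length greater than `n` vanish, so finitely many paths span. Only this finiteness is
needed, not a basis. -/
lemma mem_span_range_path (x : Nakayama K n m) :
    x ∈ Submodule.span K (Set.range fun p : ZMod m × Fin (n + 1) => path K n m p.1 p.2) := by
  induction x using nakayama_induction with
  | zero => exact zero_mem _
  | add x y hx hy => exact add_mem hx hy
  | smul r x hx => exact Submodule.smul_mem _ r hx
  | path j l =>
    by_cases h : n < l
    · rw [path_eq_zero K n j l h]
      exact zero_mem _
    · exact Submodule.subset_span ⟨(j, ⟨l, by omega⟩), rfl⟩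

instance : Module.Finite K (Nakayama K n m) :=
  Module.finite_def.2 ((Submodule.eq_top_iff'.2 (mem_span_range_path K n (m := m))) ▸
    Submodule.fg_span (Set.finite_range _))

end Form

/-! ### The algebra `N^n_n` -/

section Dual

variable (K : Type u) [Field K] {n : ℕ} [NeZero n]

lemma idem_mul_idem (i : ZMod n) : idem K n n i * idem K n n i = idem K n n i :=
  path_mul_path K n i i 0 0 (by simp)

lemma mul_idem_of_mem {i : ZMod n} {x : Nakayama K n n} (hx : x ∈ leftP K n i) :
    x * idem K n n i = x := by
  obtain ⟨z, rfl⟩ := Submodule.mem_span_singleton.1 hx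
  rw [smul_eq_mul, mul_assoc, idem_mul_idem]

lemma idem_mul_of_mem {i : ZMod n} {x : Nakayama K n n} (hx : x ∈ rightP K n i) :
    idem K n n i * x = x := by
  obtain ⟨z, rfl⟩ := Submodule.mem_span_singleton.1 hx
  rw [MulOpposite.smul_eq_mul_unop, ← mul_assoc, idem_mul_idem]

/-- Among `0, …, n` the only two distinct numbers congruent modulo `n` are `0` and `n`. This is what
limits the closed paths to the trivial path and the full cycle. -/
lemma natCast_eq_natCast_iff_of_le {k l : ℕ} (hk : k ≤ n) (hl : l ≤ n)
    (h : (k : ZMod n) = (l : ZMod n)) : k = l ∨ (k = 0 ∧ l = n) ∨ (k = n ∧ l = 0) := by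
  rw [ZMod.natCast_eq_natCast_iff] at h
  have h0 := NeZero.pos n
  by_cases hk' : k = n <;> by_cases hl' : l = n
  · omega
  · subst hk'
    have := Nat.ModEq.symm h
    rw [Nat.ModEq, Nat.mod_self, Nat.mod_eq_of_lt (by omega)] at this
    omega
  · subst hl'
    rw [Nat.ModEq, Nat.mod_self, Nat.mod_eq_of_lt (by omega)] at h
    omega
  · rw [Nat.ModEq, Nat.mod_eq_of_lt (by omega), Nat.mod_eq_of_lt (by omega)] at h
    exact Or.inl h

/-- The paths `q_l` are dual to the paths `p_l` starting at `i`. -/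
lemma sum_form_smul_path {i : ZMod n} {y : Nakayama K n n} (hy : y ∈ rightP K n i) :
    ∑ l : Fin (n + 1), nakayamaForm K n n (y * path K n n (i + ((l : ℕ) : ZMod n)) (n - l)) •
      path K n n i l = y := by
  -- Elements of `_iP` are written as `(i) y` with `y` arbitrary, so that linearity reduces the
  -- claim to single paths.
  suffices H : ∀ y : Nakayama K n n,
      ∑ l : Fin (n + 1), nakayamaForm K n n
        (idem K n n i * y * path K n n (i + ((l : ℕ) : ZMod n)) (n - l)) • path K n n i l =
      idem K n n i * y by
    have := H y
    rwa [idem_mul_of_mem K hy] at this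
  clear y hy
  intro y
  induction y using nakayama_induction with
  | zero => simp only [mul_zero, zero_mul, map_zero, zero_smul, Finset.sum_const_zero]
  | add x y hx hy =>
    simp only [mul_add, add_mul, map_add, add_smul, Finset.sum_add_distrib, hx, hy]
  | smul r x hx =>
    simp only [mul_smul_comm, smul_mul_assoc, map_smul, smul_assoc, ← Finset.smul_sum, hx]
  | path j k =>
    by_cases hj : j = i
    · subst hj
      rw [path_mul_path K n j j 0 k (by simp), zero_add]
      by_cases hk : n < k
      · simp only [path_eq_zero K n j k hk, zero_mul, map_zero, zero_smul, Finset.sum_const_zero]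
      -- For `y` the path of length `k` from `i`, the product with `q_l` is zero or a path of length
      -- `k + n - l`, so the form is nonzero only for `l = k`.
      · rw [Finset.sum_eq_single (⟨k, by omega⟩ : Fin (n + 1))]
        · rw [path_mul_path K n j _ k _ rfl, nakayamaForm_path, if_pos, one_smul]
          simp only
          omega
        · intro l _ hl
          have hl' : (l : ℕ) ≠ k := fun h => hl (Fin.ext h)
          by_cases h : (k : ZMod n) = ((l : ℕ) : ZMod n)
          · rw [path_mul_path K n j _ k _ (by rw [h]), nakayamaForm_path, if_neg, zero_smul]
            have := l.2
            omega
          · rw [path_mul_path_of_ne K n j _ k _ (fun h' => h (add_left_cancel h')), map_zero,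
              zero_smul]
        · simp
    · rw [path_mul_path_of_ne K n i j 0 k (by simpa using Ne.symm hj)]
      simp only [zero_mul, map_zero, zero_smul, Finset.sum_const_zero]

/-- The paths `p_l` are dual to the paths `q_l` ending at `i`. -/
lemma sum_form_smul_path' {i : ZMod n} {x : Nakayama K n n} (hx : x ∈ leftP K n i) :
    ∑ l : Fin (n + 1), nakayamaForm K n n (path K n n i l * x) •
      path K n n (i + ((l : ℕ) : ZMod n)) (n - l) = x := by
  suffices H : ∀ x : Nakayama K n n,
      ∑ l : Fin (n + 1), nakayamaForm K n n (path K n n i l * (x * idem K n n i)) •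
        path K n n (i + ((l : ℕ) : ZMod n)) (n - l) = x * idem K n n i by
    have := H x
    rwa [mul_idem_of_mem K hx] at this
  clear x hx
  intro x
  induction x using nakayama_induction with
  | zero => simp only [mul_zero, zero_mul, map_zero, zero_smul, Finset.sum_const_zero]
  | add x y hx hy =>
    simp only [mul_add, add_mul, map_add, add_smul, Finset.sum_add_distrib, hx, hy]
  | smul r x hx =>
    simp only [mul_smul_comm, smul_mul_assoc, map_smul, smul_assoc, ← Finset.smul_sum, hx]
  | path j k =>
    by_cases hj : j + (k : ZMod n) = i
    · rw [path_mul_path K n j i k 0 hj.symm, add_zero]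
      by_cases hk : n < k
      · simp only [path_eq_zero K n j k hk, mul_zero, map_zero, zero_smul, Finset.sum_const_zero]
      -- A path of length `k` ending at `i` starts `n - k` steps after `i`, since `n` steps close
      -- up. It is therefore `q_l` with `l = n - k`.
      · have hj' : j = i + ((n - k : ℕ) : ZMod n) := by
          rw [← hj, add_assoc, ← Nat.cast_add, Nat.add_sub_cancel' (by omega), ZMod.natCast_self,
            add_zero]
        rw [Finset.sum_eq_single (⟨n - k, by omega⟩ : Fin (n + 1))]
        · rw [path_mul_path K n i j _ k hj', nakayamaForm_path, if_pos (by omega),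
            one_smul, ← hj']
          congr 1
          simp only
          omega
        · intro l _ hl
          have hl' : (l : ℕ) ≠ n - k := fun h => hl (Fin.ext h)
          by_cases h : i + ((l : ℕ) : ZMod n) = j
          · rw [path_mul_path K n i _ _ k h.symm, nakayamaForm_path, if_neg (by omega), zero_smul]
          · rw [path_mul_path_of_ne K n i _ _ k h, map_zero, zero_smul]
        · simp
    · rw [path_mul_path_of_ne K n j i k 0 hj]
      simp only [mul_zero, map_zero, zero_smul, Finset.sum_const_zero]

/-- An element of `(i) A (i)` is a linear combination of `(i)` and of the path of length `n`. -/
lemma corner_eq {i : ZMod n} {c : Nakayama K n n} (hl : c ∈ leftP K n i) (hr : c ∈ rightP K n i) :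
    c = nakayamaForm K n n c • path K n n i n +
      nakayamaForm K n n (c * path K n n i n) • idem K n n i := by
  -- The form reads off the coefficient of the cycle. Multiplying by the cycle first turns the
  -- idempotent into the cycle and kills the cycle, so the form then reads off the coefficient of
  -- `(i)`.
  suffices H : ∀ c : Nakayama K n n, idem K n n i * c * idem K n n i =
      nakayamaForm K n n (idem K n n i * c * idem K n n i) • path K n n i n +
      nakayamaForm K n n (idem K n n i * c * idem K n n i * path K n n i n) • idem K n n i by
    have := H c
    rwa [idem_mul_of_mem K hr, mul_idem_of_mem K hl] at this
  clear c hl hr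
  have hn := NeZero.pos n
  intro c
  induction c using nakayama_induction with
  | zero => simp only [mul_zero, zero_mul, map_zero, zero_smul, add_zero]
  | add x y hx hy =>
    simp only [mul_add, add_mul, map_add, add_smul]
    rw [add_add_add_comm, ← hx, ← hy]
  | smul r x hx =>
    simp only [mul_smul_comm, smul_mul_assoc, map_smul, smul_assoc, ← smul_add, ← hx]
  | path j k =>
    by_cases hj : j = i
    · subst hj
      rw [path_mul_path K n j j 0 k (by simp), zero_add]
      by_cases h : (k : ZMod n) = 0
      · have h' : j + (k : ZMod n) = j := by rw [h, add_zero]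
        rw [path_mul_path K n j j k 0 h'.symm, add_zero, path_mul_path K n j j k n h'.symm,
          nakayamaForm_path, nakayamaForm_path]
        by_cases hk : n < k
        · rw [path_eq_zero K n j k hk, if_neg (by omega), if_neg (by omega), zero_smul, zero_smul,
            add_zero]
        · obtain h0 | h0 | h0 := natCast_eq_natCast_iff_of_le (n := n) (k := k) (l := 0)
            (by omega) (by omega) (by simpa using h)
          · subst h0
            rw [if_neg (by omega), if_pos (by omega), zero_smul, zero_add, one_smul]
          · omega
          · rw [h0.1, if_pos rfl, if_neg (by omega), zero_smul, add_zero, one_smul]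
      · rw [path_mul_path_of_ne K n j j k 0 (by simpa using h)]
        simp only [zero_mul, map_zero, zero_smul, add_zero]
    · rw [path_mul_path_of_ne K n i j 0 k (by simpa using Ne.symm hj)]
      simp only [zero_mul, map_zero, zero_smul, add_zero]

end Dual

/-! ### The bimodule `P_i ⊗ _iP ⊗_A P_i ⊗ _iP` -/

section Square

variable (K : Type u) [Field K] {n : ℕ} [NeZero n] (i : ZMod n)

/-- The bilinear form `(c, d) ↦ form (c d)` on `_iP × P_i`. -/
def pairing : rightP K n i →ₗ[K] leftP K n i →ₗ[K] K :=
  ((LinearMap.mul K (Nakayama K n n)).compl₁₂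
    ((rightP K n i).subtype.restrictScalars K)
    ((leftP K n i).subtype.restrictScalars K)).compr₂ (nakayamaForm K n n)

/-- The map `(x ⊗ c) ⊗ (d ⊗ y) ↦ x ⊗ form (c d) y`. -/
def contractLin : (leftP K n i ⊗[K] rightP K n i) →ₗ[K] (leftP K n i ⊗[K] rightP K n i) →ₗ[K]
    (leftP K n i ⊗[K] rightP K n i) :=
  TensorProduct.curry ((LinearMap.lTensor (leftP K n i)
    ((TensorProduct.lid K (rightP K n i)).toLinearMap ∘ₗ
      LinearMap.rTensor (rightP K n i) (TensorProduct.lift (pairing K i)) ∘ₗ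
      (TensorProduct.assoc K (rightP K n i) (leftP K n i) (rightP K n i)).symm.toLinearMap)) ∘ₗ
    (TensorProduct.assoc K (leftP K n i) (rightP K n i)
      (leftP K n i ⊗[K] rightP K n i)).toLinearMap)

/-- The biadditive map `(x ⊗ c, d ⊗ y) ↦ x ⊗ form (c d) y`. -/
def contractAdd : PP K n i →+ PP K n i →+ PP K n i :=
  AddMonoidHom.mk' (fun t => (contractLin K i t).toAddMonoidHom) (by
    intro s t
    ext u
    exact LinearMap.congr_fun (map_add (contractLin K i) s t) u)

variable {i}

lemma PP_induction {p : PP K n i → Prop} (h0 : p 0)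
    (ht : ∀ x y, p (Outer.tmul K (Nakayama K n n) x y)) (ha : ∀ s t, p s → p t → p (s + t))
    (t : PP K n i) : p t :=
  Outer.induction (K := K) (A := Nakayama K n n) (M := leftP K n i) (N := rightP K n i)
    (p := p) h0 ht ha t

/-- This reduces the balancedness and equivariance of `contractAdd` to pure tensors. -/
lemma PP_biadd_ext {Z : Type*} [AddCommGroup Z] {f g : PP K n i →+ PP K n i →+ Z}
    (h : ∀ x c d y, f (Outer.tmul K (Nakayama K n n) x c) (Outer.tmul K (Nakayama K n n) d y) =
      g (Outer.tmul K (Nakayama K n n) x c) (Outer.tmul K (Nakayama K n n) d y)) : f = g := by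
  ext s t
  induction s using PP_induction with
  | h0 => simp only [map_zero, AddMonoidHom.zero_apply]
  | ha s s' hs hs' => simp only [map_add, AddMonoidHom.add_apply, hs, hs']
  | ht x c =>
    induction t using PP_induction with
    | h0 => simp only [map_zero]
    | ha s s' hs hs' => simp only [map_add, hs, hs']
    | ht d y => exact h x c d y

variable (i)

/-- The morphism `(x ⊗ c) ⊗ (d ⊗ y) ↦ x ⊗ form (c d) y`. -/
def contract : tensorObj (PP K n i) (PP K n i) ⟶ PP K n i :=
  tensorLift (contractAdd K i)
    (by
      intro s a t
      -- Both sides are read as biadditive maps in `s` and `t`; on pure tensors the claim is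
      -- associativity, `(c a) d = c (a d)`.
      refine DFunLike.congr_fun (DFunLike.congr_fun (PP_biadd_ext K
        (f := (contractAdd K i).comp (envSMul (PP K n i) (1 ⊗ₜ[K] MulOpposite.op a)))
        (g := (contractAdd K i).compl₂ (envSMul (PP K n i) (a ⊗ₜ[K] 1))) ?_) s) t
      intro x c d y
      change Outer.tmul K (Nakayama K n n) ((1 : Nakayama K n n) • x)
        (nakayamaForm K n n ((c * a : Nakayama K n n) * d) • y) =
          Outer.tmul K (Nakayama K n n) x (nakayamaForm K n n
            (c * (a * d) : Nakayama K n n) • (1 : (Nakayama K n n)ᵐᵒᵖ) • y)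
      rw [one_smul, one_smul, mul_assoc])
    (by
      intro a b s t
      refine DFunLike.congr_fun (DFunLike.congr_fun (PP_biadd_ext K
        (f := ((contractAdd K i).comp (envSMul (PP K n i) (a ⊗ₜ[K] 1))).compl₂
          (envSMul (PP K n i) (1 ⊗ₜ[K] b)))
        (g := (contractAdd K i).compr₂ (envSMul (PP K n i) (a ⊗ₜ[K] b))) ?_) s) t
      intro x c d y
      change Outer.tmul K (Nakayama K n n) (a • x)
        (nakayamaForm K n n ((c * 1 : Nakayama K n n) * (1 * d)) • b • y) =
          Outer.tmul K (Nakayama K n n) (a • x) (b • nakayamaForm K n n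
            (c * d : Nakayama K n n) • y)
      rw [one_mul, mul_one, smul_comm])

/-- The idempotent `(i)` in `P_i`. -/
def idemLeft : leftP K n i := ⟨idem K n n i, Submodule.mem_span_singleton_self _⟩

/-- The idempotent `(i)` in `_iP`. -/
def idemRight : rightP K n i := ⟨idem K n n i, Submodule.mem_span_singleton_self _⟩

/-- The path of length `n` in `_iP`. -/
def cycleRight : rightP K n i := ⟨path K n n i n, path_mem_rightP K n i n⟩

variable {i}

/-- The element `(x ⊗ c) ⊗ (d ⊗ y)`. -/
def mk₄ (x : leftP K n i) (c : rightP K n i) (d : leftP K n i) (y : rightP K n i) :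
    tensorObj (PP K n i) (PP K n i) :=
  tensorMk (X := PP K n i) (Y := PP K n i)
    (Outer.tmul K (Nakayama K n n) x c) (Outer.tmul K (Nakayama K n n) d y)

lemma contract_mk₄ (x d : leftP K n i) (c y : rightP K n i) :
    (contract K i).hom (mk₄ K x c d y) =
      Outer.tmul K (Nakayama K n n) x (nakayamaForm K n n (c * d : Nakayama K n n) • y) := rfl

section

variable (x x' d d' : leftP K n i) (c c' y y' : rightP K n i) (k : K)

lemma Outer.smul_tmul_comm :
    Outer.tmul K (Nakayama K n n) (k • x) y = Outer.tmul K (Nakayama K n n) x (k • y) :=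
  TensorProduct.smul_tmul k x y

lemma mk₄_add_first : mk₄ K (x + x') c d y = mk₄ K x c d y + mk₄ K x' c d y :=
  (congrArg (fun t => tensorMk (X := PP K n i) (Y := PP K n i) t
    (Outer.tmul K (Nakayama K n n) d y)) (TensorProduct.add_tmul x x' c)).trans
    (tensorMk_add_left _ _ _)

lemma mk₄_add_second : mk₄ K x (c + c') d y = mk₄ K x c d y + mk₄ K x c' d y :=
  (congrArg (fun t => tensorMk (X := PP K n i) (Y := PP K n i) t
    (Outer.tmul K (Nakayama K n n) d y)) (TensorProduct.tmul_add x c c')).trans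
    (tensorMk_add_left _ _ _)

lemma mk₄_add_last : mk₄ K x c d (y + y') = mk₄ K x c d y + mk₄ K x c d y' :=
  (congrArg (fun t => tensorMk (X := PP K n i) (Y := PP K n i)
    (Outer.tmul K (Nakayama K n n) x c) t) (TensorProduct.tmul_add d y y')).trans
    (tensorMk_add_right _ _ _)

lemma mk₄_smul_first : mk₄ K (k • x) c d y = mk₄ K x (k • c) d y := by
  rw [mk₄, Outer.smul_tmul_comm]
  rfl

/-- Since `d = d (i)`, the factor `d` can be carried across `⊗_A` and absorbed into `c`. Thus the
two middle factors matter only through their product in `(i)A(i)`. -/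
lemma mk₄_eq_mul (h : (c * d : Nakayama K n n) ∈ rightP K n i) :
    mk₄ K x c d y = mk₄ K x ⟨c * d, h⟩ (idemLeft K i) y := by
  have e := tensorMk_balanced (X := PP K n i) (Y := PP K n i)
    (Outer.tmul K (Nakayama K n n) x c) (d : Nakayama K n n)
    (Outer.tmul K (Nakayama K n n) (idemLeft K i) y)
  rw [Outer.smul_tmul, Outer.smul_tmul, one_smul, one_smul] at e
  have h1 : (d : Nakayama K n n) • idemLeft K i = d := Subtype.ext (mul_idem_of_mem K d.2)
  rw [h1] at e
  exact e.symm

/-- The scalar passes from `c` across `⊗_A` into the third factor, and from there across `⊗_K` to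
`y`. -/
lemma mk₄_smul_second :
    mk₄ K x (k • c) (idemLeft K i) y = mk₄ K x c (idemLeft K i) (k • y) := by
  have hm : (c : Nakayama K n n) * (k • idemLeft K i : leftP K n i) ∈ rightP K n i :=
    Submodule.smul_mem _ (MulOpposite.op _) c.2
  have e : mk₄ K x c (k • idemLeft K i) y = mk₄ K x c (idemLeft K i) (k • y) := by
    rw [mk₄, Outer.smul_tmul_comm]
    rfl
  rw [← e, mk₄_eq_mul K x _ c y hm, mk₄_eq_mul K x (idemLeft K i) (k • c) y
    (Submodule.smul_mem _ (MulOpposite.op _) (k • c).2)]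
  congr 1
  apply Subtype.ext
  change (k • (c : Nakayama K n n)) * idem K n n i = (c : Nakayama K n n) * (k • idem K n n i)
  rw [smul_mul_assoc, mul_smul_comm]

end

lemma mk₄_induction {p : tensorObj (PP K n i) (PP K n i) → Prop} (zero : p 0)
    (mk : ∀ x c d y, p (mk₄ K x c d y)) (add : ∀ s t, p s → p t → p (s + t))
    (t : tensorObj (PP K n i) (PP K n i)) : p t := by
  induction t using tensor_induction with
  | zero => exact zero
  | add s t hs ht => exact add s t hs ht
  | mk s t =>
    induction s using PP_induction with
    | h0 => rw [tensorMk_zero_left]; exact zero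
    | ha s s' hs hs' => rw [tensorMk_add_left]; exact add _ _ hs hs'
    | ht x c =>
      induction t using PP_induction with
      | h0 => rw [tensorMk_zero_right]; exact zero
      | ha s s' hs hs' => rw [tensorMk_add_right]; exact add _ _ hs hs'
      | ht d y => exact mk x c d y

variable (i)

/-- The morphism `x ⊗ y ↦ (x ⊗ (i)) ⊗ ((i) ⊗ y)`. -/
def insert : PP K n i ⟶ tensorObj (PP K n i) (PP K n i) :=
  ModuleCat.ofHom (Outer.lift
    (AddMonoidHom.mk' (fun x => AddMonoidHom.mk'
      (fun y => mk₄ K x (idemRight K i) (idemLeft K i) y) (fun y y' => mk₄_add_last K _ _ _ _ _))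
      (fun x x' => by ext y; exact mk₄_add_first K _ _ _ _ _))
    (fun k x y => by
      change mk₄ K _ _ _ _ = mk₄ K _ _ _ _
      rw [mk₄_smul_first, mk₄_smul_second])
    (fun a b x y => by
      change mk₄ K (a • x) (idemRight K i) (idemLeft K i) (b • y) =
        mk₄ K (a • x) ((1 : (Nakayama K n n)ᵐᵒᵖ) • idemRight K i)
          ((1 : Nakayama K n n) • idemLeft K i) (b • y)
      rw [one_smul, one_smul]))

variable {i}

/-- Modulo the image of `insert`, the middle factor can be replaced by a multiple of the
path of length `n`. -/
lemma mk₄_sub_mem_range (x d : leftP K n i) (c y : rightP K n i) :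
    mk₄ K x c d y - mk₄ K x (nakayamaForm K n n (c * d : Nakayama K n n) • cycleRight K i)
      (idemLeft K i) y ∈ LinearMap.range (insert K i).hom := by
  have hr : (c * d : Nakayama K n n) ∈ rightP K n i :=
    Submodule.smul_mem _ (MulOpposite.op _) c.2
  have hl : (c * d : Nakayama K n n) ∈ leftP K n i := Submodule.smul_mem _ _ d.2
  set τ := nakayamaForm K n n (c * d : Nakayama K n n)
  set κ := nakayamaForm K n n ((c * d : Nakayama K n n) * path K n n i n)
  -- In the decomposition of the product `c d` in `(i)A(i)`, the cycle part is the subtracted term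
  -- and the idempotent part lies in the image of `insert`.
  have e : (⟨c * d, hr⟩ : rightP K n i) = τ • cycleRight K i + κ • idemRight K i :=
    Subtype.ext (corner_eq K hl hr)
  rw [mk₄_eq_mul K x d c y hr, e, mk₄_add_second, add_sub_cancel_left, ← mk₄_smul_first]
  exact ⟨Outer.tmul K (Nakayama K n n) (κ • x) y, rfl⟩

variable (i)

/-- The morphism `P_i ⊗ _iP ⟶ P_i ⊗ _iP ⊗_A P_i ⊗ _iP` induced by `β_i` on the right. -/
def coactRight : PP K n i ⟶ tensorObj (PP K n i) (PP K n i) :=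
  (tensorRightUnit (PP K n i)).inv ≫ tensorMap (𝟙 _) (beta K i)

/-- The morphism `P_i ⊗ _iP ⟶ P_i ⊗ _iP ⊗_A P_i ⊗ _iP` induced by `β_i` on the left. -/
def coactLeft : PP K n i ⟶ tensorObj (PP K n i) (PP K n i) :=
  (tensorLeftUnit (PP K n i)).inv ≫ tensorMap (beta K i) (𝟙 _)

/-- The morphism `P_i ⊗ _iP ⊗_A P_i ⊗ _iP ⟶ P_i ⊗ _iP` induced by `α_i` on the left. -/
def actLeft : tensorObj (PP K n i) (PP K n i) ⟶ PP K n i :=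
  tensorMap (alpha K n i) (𝟙 _) ≫ (tensorLeftUnit (PP K n i)).hom

/-- The morphism `P_i ⊗ _iP ⊗_A P_i ⊗ _iP ⟶ P_i ⊗ _iP` induced by `α_i` on the right. -/
def actRight : tensorObj (PP K n i) (PP K n i) ⟶ PP K n i :=
  tensorMap (𝟙 _) (alpha K n i) ≫ (tensorRightUnit (PP K n i)).hom

/-- The path `q_l` in `P_i`. -/
def dualPath (l : Fin (n + 1)) : leftP K n i :=
  ⟨path K n n (i + ((l : ℕ) : ZMod n)) (n - l), path_mem_leftP K n i _ _ (cycle_end i l)⟩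

/-- The path `p_l` in `_iP`. -/
def startPath (l : Fin (n + 1)) : rightP K n i := ⟨path K n n i l, path_mem_rightP K n i l⟩

lemma sum_form_smul_startPath (y : rightP K n i) :
    ∑ l, nakayamaForm K n n (y * dualPath K i l : Nakayama K n n) • startPath K i l = y :=
  Subtype.ext (by
    rw [AddSubmonoidClass.coe_finsetSum]
    exact sum_form_smul_path K y.2)

lemma sum_form_smul_dualPath (x : leftP K n i) :
    ∑ l, nakayamaForm K n n (startPath K i l * x : Nakayama K n n) • dualPath K i l = x :=
  Subtype.ext (by
    rw [AddSubmonoidClass.coe_finsetSum]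
    exact sum_form_smul_path' K x.2)

variable {i}

lemma coactRight_tmul (x : leftP K n i) (y : rightP K n i) :
    (coactRight K i).hom (Outer.tmul K (Nakayama K n n) x y) =
      ∑ l, mk₄ K x y (dualPath K i l) (startPath K i l) := by
  change tensorMk (X := PP K n i) (Y := PP K n i) (Outer.tmul K (Nakayama K n n) x y)
    ((beta K i).hom (1 : Nakayama K n n)) = _
  rw [beta_one]
  exact tensorMk_sum_right _ _ _

lemma coactLeft_tmul (x : leftP K n i) (y : rightP K n i) :
    (coactLeft K i).hom (Outer.tmul K (Nakayama K n n) x y) =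
      ∑ l, mk₄ K (dualPath K i l) (startPath K i l) x y := by
  change tensorMk (X := PP K n i) (Y := PP K n i) ((beta K i).hom (1 : Nakayama K n n))
    (Outer.tmul K (Nakayama K n n) x y) = _
  rw [beta_one]
  exact tensorMk_sum_left _ _ _

lemma PP_hom_ext {Z : BimodCat K (Nakayama K n n)} {f g : PP K n i ⟶ Z}
    (h : ∀ x y, f.hom (Outer.tmul K (Nakayama K n n) x y) =
      g.hom (Outer.tmul K (Nakayama K n n) x y)) : f = g := by
  ext t
  induction t using PP_induction with
  | h0 => rw [map_zero, map_zero]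
  | ha s s' hs hs' => rw [map_add, map_add, hs, hs']
  | ht x y => exact h x y

variable (i)

/-- The form pairs `y` with the `q_l`, and the `p_l` reassemble `y` by duality. -/
lemma coactRight_contract : coactRight K i ≫ contract K i = 𝟙 _ := PP_hom_ext K (by
  intro x y
  change (contract K i).hom ((coactRight K i).hom (Outer.tmul K (Nakayama K n n) x y)) =
    Outer.tmul K (Nakayama K n n) x y
  rw [coactRight_tmul, map_sum]
  conv_rhs => rw [← sum_form_smul_startPath K i y]
  exact (TensorProduct.tmul_sum x Finset.univ _).symm)

/-- Mirror argument: the form pairs the `p_l` with `x`, and the `q_l` reassemble `x`. -/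
lemma coactLeft_contract : coactLeft K i ≫ contract K i = 𝟙 _ := PP_hom_ext K (by
  intro x y
  change (contract K i).hom ((coactLeft K i).hom (Outer.tmul K (Nakayama K n n) x y)) =
    Outer.tmul K (Nakayama K n n) x y
  rw [coactLeft_tmul, map_sum]
  conv_rhs => rw [← sum_form_smul_dualPath K i x]
  refine (Finset.sum_congr rfl fun l _ => ?_).trans (TensorProduct.sum_tmul Finset.univ _ y).symm
  rw [contract_mk₄]
  exact (Outer.smul_tmul_comm K _ _ _).symm)

lemma insert_actLeft : insert K i ≫ actLeft K i = 𝟙 _ := PP_hom_ext K (by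
  intro x y
  change Outer.tmul K (Nakayama K n n) ((x * idem K n n i : Nakayama K n n) • idemLeft K i)
    ((1 : (Nakayama K n n)ᵐᵒᵖ) • y) = Outer.tmul K (Nakayama K n n) x y
  rw [one_smul]
  congr 1
  apply Subtype.ext
  change (x * idem K n n i : Nakayama K n n) * idem K n n i = x
  rw [mul_idem_of_mem K x.2, mul_idem_of_mem K x.2])

lemma insert_actRight : insert K i ≫ actRight K i = 𝟙 _ := PP_hom_ext K (by
  intro x y
  change Outer.tmul K (Nakayama K n n) ((1 : Nakayama K n n) • x)
    (MulOpposite.op (idem K n n i * y : Nakayama K n n) • idemRight K i) =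
      Outer.tmul K (Nakayama K n n) x y
  rw [one_smul]
  congr 1
  apply Subtype.ext
  change idem K n n i * (idem K n n i * y : Nakayama K n n) = y
  rw [idem_mul_of_mem K y.2, idem_mul_of_mem K y.2])

lemma insert_contract : insert K i ≫ contract K i = 0 := PP_hom_ext K (by
  intro x y
  change Outer.tmul K (Nakayama K n n) x
    (nakayamaForm K n n (idem K n n i * idem K n n i : Nakayama K n n) • y) = 0
  -- The form vanishes on `(i)` because `n` is not `0`.
  rw [idem_mul_idem, nakayamaForm_path, if_neg (NeZero.ne' n), zero_smul]
  exact Outer.tmul_zero _)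

/-- Modulo the idempotent copy each middle factor `y q_l` may be replaced by its form value times
the cycle; the form values then move to `p_l` and sum to `y`. So `coactRight` is congruent to the
embedding through the cycle, and so is `coactLeft` below. -/
lemma coactRight_sub_mem_range (x : leftP K n i) (y : rightP K n i) :
    (coactRight K i).hom (Outer.tmul K (Nakayama K n n) x y) -
      mk₄ K x (cycleRight K i) (idemLeft K i) y ∈ LinearMap.range (insert K i).hom := by
  have e : mk₄ K x (cycleRight K i) (idemLeft K i) y = ∑ l, mk₄ K x
      (nakayamaForm K n n (y * dualPath K i l : Nakayama K n n) • cycleRight K i)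
      (idemLeft K i) (startPath K i l) := by
    simp only [mk₄_smul_second]
    conv_lhs => rw [← sum_form_smul_startPath K i y]
    exact map_sum (AddMonoidHom.mk' (fun y => mk₄ K x (cycleRight K i) (idemLeft K i) y)
      (mk₄_add_last K _ _ _)) _ _
  rw [coactRight_tmul, e, ← Finset.sum_sub_distrib]
  exact Submodule.sum_mem _ fun l _ => mk₄_sub_mem_range K _ _ _ _

lemma coactLeft_sub_mem_range (x : leftP K n i) (y : rightP K n i) :
    (coactLeft K i).hom (Outer.tmul K (Nakayama K n n) x y) -
      mk₄ K x (cycleRight K i) (idemLeft K i) y ∈ LinearMap.range (insert K i).hom := by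
  have e : mk₄ K x (cycleRight K i) (idemLeft K i) y = ∑ l, mk₄ K (dualPath K i l)
      (nakayamaForm K n n (startPath K i l * x : Nakayama K n n) • cycleRight K i)
      (idemLeft K i) y := by
    simp only [← mk₄_smul_first]
    conv_lhs => rw [← sum_form_smul_dualPath K i x]
    exact map_sum (AddMonoidHom.mk' (fun x => mk₄ K x (cycleRight K i) (idemLeft K i) y)
      (fun x x' => mk₄_add_first K x x' _ _ _)) _ _
  rw [coactLeft_tmul, e, ← Finset.sum_sub_distrib]
  exact Submodule.sum_mem _ fun l _ => mk₄_sub_mem_range K _ _ _ _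

variable {i}

/-- For every `t`, both `t` and `b (contract t)` are congruent to the same multiple of the cycle
modulo the image of `insert`, so their difference lies in that image. There `m ≫ insert` is the
identity because `insert ≫ m` is. Leaving `b` and `m` general serves both orders of the tensor
product. -/
lemma contraction_identity {b : PP K n i ⟶ tensorObj (PP K n i) (PP K n i)}
    {m : tensorObj (PP K n i) (PP K n i) ⟶ PP K n i}
    (hb : ∀ x y, b.hom (Outer.tmul K (Nakayama K n n) x y) -
      mk₄ K x (cycleRight K i) (idemLeft K i) y ∈ LinearMap.range (insert K i).hom)
    (hm : insert K i ≫ m = 𝟙 _) :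
    (𝟙 _ - contract K i ≫ b) ≫ (𝟙 _ - m ≫ insert K i) = 0 := by
  have key : ∀ t : tensorObj (PP K n i) (PP K n i),
      t - b.hom ((contract K i).hom t) ∈ LinearMap.range (insert K i).hom := by
    intro t
    induction t using mk₄_induction with
    | zero => rw [map_zero, map_zero, sub_zero]; exact zero_mem _
    | add s t hs ht => rw [map_add, map_add, add_sub_add_comm]; exact add_mem hs ht
    | mk x c d y =>
      have h := sub_mem (mk₄_sub_mem_range K x d c y)
        (hb x (nakayamaForm K n n (c * d : Nakayama K n n) • y))
      rw [mk₄_smul_second, sub_sub_sub_cancel_right] at h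
      exact h
  refine ModuleCat.hom_ext (LinearMap.ext fun t => ?_)
  obtain ⟨s, hs⟩ := key t
  change (t - b.hom ((contract K i).hom t)) -
    (insert K i).hom (m.hom (t - b.hom ((contract K i).hom t))) = 0
  rw [← hs, sub_eq_zero]
  have := congrArg (fun f => f.hom s) hm
  exact congrArg (insert K i).hom this.symm

variable (i)

/-- `α_i` and `β_i` act on different tensor factors, hence commute; naturality of the unit
isomorphisms does the rest. This is the relation that makes the square a complex, once the sign is
inserted. -/
lemma coactRight_actLeft : coactRight K i ≫ actLeft K i = alpha K n i ≫ beta K i := by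
  have h1 : tensorMap (𝟙 (PP K n i)) (beta K i) ≫ tensorMap (alpha K n i) (𝟙 _) =
      tensorMap (alpha K n i) (𝟙 _) ≫ tensorMap (𝟙 _) (beta K i) :=
    tensor_hom_ext fun _ _ => rfl
  rw [coactRight, actLeft, Category.assoc, reassoc_of% h1, tensorLeftUnit_naturality,
    Iso.inv_comp_eq, tensorLeftUnit_eq_tensorRightUnit,
    reassoc_of% tensorRightUnit_naturality (alpha K n i)]

lemma coactLeft_actRight : coactLeft K i ≫ actRight K i = alpha K n i ≫ beta K i := by
  have h1 : tensorMap (beta K i) (𝟙 (PP K n i)) ≫ tensorMap (𝟙 _) (alpha K n i) =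
      tensorMap (𝟙 _) (alpha K n i) ≫ tensorMap (beta K i) (𝟙 _) :=
    tensor_hom_ext fun _ _ => rfl
  rw [coactLeft, actRight, Category.assoc, reassoc_of% h1, tensorRightUnit_naturality,
    Iso.inv_comp_eq, ← tensorLeftUnit_eq_tensorRightUnit,
    reassoc_of% tensorLeftUnit_naturality (alpha K n i)]

end Square

attribute [local instance] HasDerivedCategory.standard

/-! ### The tensor products of `F_i` and `F_i'` -/

section TensorProducts

open Limits HomologicalComplex

variable (K : Type u) [Field K] {n : ℕ} [NeZero n] (i : ZMod n)

lemma nonempty_homotopyEquiv_tensor_F_F' :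
    Nonempty (HomotopyEquiv (tensorCpx (F K i) (F' K i)) (unitCpx K (Nakayama K n n))) := by
  -- The type is spelled out so that values of the bifunctor appear as `tensorObj` and `tensorMap`.
  obtain ⟨e₁, e₂, e₃, h₁, h₂⟩ : ∃
      (e₁ : (tensorCpx (F K i) (F' K i)).X (-1) ≅
        tensorObj (PP K n i) (regularBimod K (Nakayama K n n)))
      (e₂ : (tensorCpx (F K i) (F' K i)).X 0 ≅
        tensorObj (PP K n i) (PP K n i) ⊞
          tensorObj (regularBimod K (Nakayama K n n)) (regularBimod K (Nakayama K n n)))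
      (e₃ : (tensorCpx (F K i) (F' K i)).X 1 ≅
        tensorObj (regularBimod K (Nakayama K n n)) (PP K n i)),
      (tensorCpx (F K i) (F' K i)).d (-1) 0 = e₁.hom ≫
        biprod.lift ((-1 : ℤ).negOnePow • tensorMap (𝟙 (PP K n i)) (beta K i))
          (tensorMap (alpha K n i) (𝟙 (regularBimod K (Nakayama K n n)))) ≫ e₂.inv ∧
      (tensorCpx (F K i) (F' K i)).d 0 1 = e₂.hom ≫
        biprod.desc (tensorMap (alpha K n i) (𝟙 (PP K n i)))
          ((0 : ℤ).negOnePow • tensorMap (𝟙 (regularBimod K (Nakayama K n n))) (beta K i)) ≫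
        e₃.inv :=
    exists_mapBifunctor_double_iso (alpha K n i) (beta K i)
    (tensorBifunctor K (Nakayama K n n))
    (show (ComplexShape.up ℤ).Rel (-1) 0 from neg_add_cancel (1 : ℤ))
    (show (ComplexShape.up ℤ).Rel 0 1 from zero_add (1 : ℤ)) (by omega)
  refine nonempty_homotopyEquiv_of_square (tensorCpx (F K i) (F' K i))
    (isZero_mapBifunctor_X _ (neg_add_cancel 1) (zero_add 1) (by omega)
      (fun k => isZero_double_X _ _ k) (fun k => isZero_double_X _ _ k))
    (e₁ ≪≫ tensorRightUnit (PP K n i))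
    (e₂ ≪≫ biprod.mapIso (Iso.refl _) (tensorLeftUnit (regularBimod K (Nakayama K n n))))
    (e₃ ≪≫ tensorLeftUnit (PP K n i))
    -- The sign `(-1)^(-1)` on `1 ⊗ β_i` goes into `b`, and `r = -contract` compensates for it.
    (-coactRight K i) (alpha K n i) (actLeft K i) (beta K i) (-contract K i) (insert K i)
    ?_ ?_ ?_ ?_ ?_ ?_ ?_
  · refine h₁.trans ?_
    have key : biprod.lift ((-1 : ℤ).negOnePow • tensorMap (𝟙 (PP K n i)) (beta K i))
        (tensorMap (alpha K n i) (𝟙 (regularBimod K (Nakayama K n n)))) =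
        (tensorRightUnit (PP K n i)).hom ≫ biprod.lift (-coactRight K i) (alpha K n i) ≫
          (biprod.mapIso (Iso.refl _)
            (tensorLeftUnit (regularBimod K (Nakayama K n n)))).inv := by
      rw [← Category.assoc, Iso.eq_comp_inv]
      apply biprod.hom_ext
      · simp [coactRight]
      · simp [tensorLeftUnit_eq_tensorRightUnit, tensorRightUnit_naturality]
    rw [Iso.trans_hom, Iso.trans_inv]
    simp only [Category.assoc]
    rw [← reassoc_of% key]
  · refine h₂.trans ?_
    have key : biprod.desc (tensorMap (alpha K n i) (𝟙 (PP K n i)))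
        ((0 : ℤ).negOnePow • tensorMap (𝟙 (regularBimod K (Nakayama K n n))) (beta K i)) =
        (biprod.mapIso (Iso.refl _)
            (tensorLeftUnit (regularBimod K (Nakayama K n n)))).hom ≫
          biprod.desc (actLeft K i) (beta K i) ≫ (tensorLeftUnit (PP K n i)).inv := by
      rw [← Category.assoc, Iso.eq_comp_inv]
      apply biprod.hom_ext'
      · simp [actLeft]
      · simp [tensorLeftUnit_naturality]
    rw [Iso.trans_hom, Iso.trans_inv]
    simp only [Category.assoc]
    rw [← reassoc_of% key]
  · rw [Preadditive.neg_comp, coactRight_actLeft, neg_add_cancel]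
  · rw [Preadditive.neg_comp, Preadditive.comp_neg, neg_neg, coactRight_contract]
  · exact insert_actLeft K i
  · rw [Preadditive.comp_neg, insert_contract, neg_zero]
  · rw [Preadditive.neg_comp, Preadditive.comp_neg, neg_neg]
    exact contraction_identity K (i := i) (coactRight_sub_mem_range K i) (insert_actLeft K i)

lemma nonempty_homotopyEquiv_tensor_F'_F :
    Nonempty (HomotopyEquiv (tensorCpx (F' K i) (F K i)) (unitCpx K (Nakayama K n n))) := by
  obtain ⟨e₁, e₂, e₃, h₁, h₂⟩ : ∃
      (e₁ : (tensorCpx (F' K i) (F K i)).X (-1) ≅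
        tensorObj (regularBimod K (Nakayama K n n)) (PP K n i))
      (e₂ : (tensorCpx (F' K i) (F K i)).X 0 ≅
        tensorObj (regularBimod K (Nakayama K n n)) (regularBimod K (Nakayama K n n)) ⊞
          tensorObj (PP K n i) (PP K n i))
      (e₃ : (tensorCpx (F' K i) (F K i)).X 1 ≅
        tensorObj (PP K n i) (regularBimod K (Nakayama K n n))),
      (tensorCpx (F' K i) (F K i)).d (-1) 0 = e₁.hom ≫
        biprod.lift
          ((0 : ℤ).negOnePow • tensorMap (𝟙 (regularBimod K (Nakayama K n n))) (alpha K n i))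
          (tensorMap (beta K i) (𝟙 (PP K n i))) ≫ e₂.inv ∧
      (tensorCpx (F' K i) (F K i)).d 0 1 = e₂.hom ≫
        biprod.desc (tensorMap (beta K i) (𝟙 (regularBimod K (Nakayama K n n))))
          ((1 : ℤ).negOnePow • tensorMap (𝟙 (PP K n i)) (alpha K n i)) ≫ e₃.inv :=
    exists_mapBifunctor_double_iso (beta K i) (alpha K n i)
    (tensorBifunctor K (Nakayama K n n))
    (show (ComplexShape.up ℤ).Rel 0 1 from zero_add (1 : ℤ))
    (show (ComplexShape.up ℤ).Rel (-1) 0 from neg_add_cancel (1 : ℤ)) (by omega)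
  refine nonempty_homotopyEquiv_of_square (tensorCpx (F' K i) (F K i))
    (isZero_mapBifunctor_X _ (zero_add 1) (neg_add_cancel 1) (by omega)
      (fun k => isZero_double_X _ _ k) (fun k => isZero_double_X _ _ k))
    (e₁ ≪≫ tensorLeftUnit (PP K n i))
    -- In this order `A ⊗_A A` is the first summand in degree `0`, so the summands are exchanged.
    (e₂ ≪≫ (biprod.braiding _ _ ≪≫
      biprod.mapIso (Iso.refl _) (tensorLeftUnit (regularBimod K (Nakayama K n n)))))
    (e₃ ≪≫ tensorRightUnit (PP K n i))
    -- The Koszul sign now sits on `1 ⊗ α_i` out of first degree `1`, so `m` and its section `j`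
    -- carry the minus signs.
    (coactLeft K i) (alpha K n i) (-actRight K i) (beta K i) (contract K i) (-insert K i)
    ?_ ?_ ?_ ?_ ?_ ?_ ?_
  · refine h₁.trans ?_
    have key : biprod.lift
        ((0 : ℤ).negOnePow • tensorMap (𝟙 (regularBimod K (Nakayama K n n))) (alpha K n i))
        (tensorMap (beta K i) (𝟙 (PP K n i))) =
        (tensorLeftUnit (PP K n i)).hom ≫ biprod.lift (coactLeft K i) (alpha K n i) ≫
          (biprod.braiding _ _ ≪≫ biprod.mapIso (Iso.refl _)
            (tensorLeftUnit (regularBimod K (Nakayama K n n)))).inv := by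
      rw [← Category.assoc, Iso.eq_comp_inv]
      apply biprod.hom_ext
      · simp [coactLeft]
      · simp [tensorLeftUnit_naturality]
    rw [Iso.trans_hom, Iso.trans_inv]
    simp only [Category.assoc]
    rw [← reassoc_of% key]
  · refine h₂.trans ?_
    have key : biprod.desc
        (tensorMap (beta K i) (𝟙 (regularBimod K (Nakayama K n n))))
        ((1 : ℤ).negOnePow • tensorMap (𝟙 (PP K n i)) (alpha K n i)) =
        (biprod.braiding _ _ ≪≫ biprod.mapIso (Iso.refl _)
            (tensorLeftUnit (regularBimod K (Nakayama K n n)))).hom ≫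
          biprod.desc (-actRight K i) (beta K i) ≫ (tensorRightUnit (PP K n i)).inv := by
      have inl_swap : ∀ X Y : BimodCat K (Nakayama K n n),
          biprod.inl ≫ biprod.lift (biprod.snd : X ⊞ Y ⟶ Y) biprod.fst = biprod.inr := by
        intro X Y
        apply biprod.hom_ext <;> simp
      have inr_swap : ∀ X Y : BimodCat K (Nakayama K n n),
          biprod.inr ≫ biprod.lift (biprod.snd : X ⊞ Y ⟶ Y) biprod.fst = biprod.inl := by
        intro X Y
        apply biprod.hom_ext <;> simp
      rw [← Category.assoc, Iso.eq_comp_inv]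
      apply biprod.hom_ext'
      · simp [tensorLeftUnit_eq_tensorRightUnit, tensorRightUnit_naturality,
          reassoc_of% inl_swap]
      · simp [actRight, reassoc_of% inr_swap]
    rw [Iso.trans_hom, Iso.trans_inv]
    simp only [Category.assoc]
    rw [← reassoc_of% key]
  · rw [Preadditive.comp_neg, coactLeft_actRight, neg_add_cancel]
  · exact coactLeft_contract K i
  · rw [Preadditive.neg_comp, Preadditive.comp_neg, neg_neg, insert_actRight]
  · rw [Preadditive.neg_comp, insert_contract, neg_zero]
  · rw [Preadditive.neg_comp, Preadditive.comp_neg, neg_neg]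
    exact contraction_identity K (i := i) (coactLeft_sub_mem_range K i) (insert_actRight K i)

lemma DerivedIso.of_homotopyEquiv {R : Type u} [Ring R] {X Y : CochainComplex (ModuleCat.{u} R) ℤ}
    (h : Nonempty (HomotopyEquiv X Y)) : DerivedIso X Y := by
  obtain ⟨e⟩ := h
  have : QuasiIso e.hom := e.quasiIso_hom
  exact ⟨asIso (DerivedCategory.Q.map e.hom)⟩

lemma DerivedIso.refl {R : Type u} [Ring R] (X : CochainComplex (ModuleCat.{u} R) ℤ) :
    DerivedIso X X := ⟨Iso.refl _⟩

end TensorProducts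

/-! ### Projectivity -/

section Projective

variable {K : Type u} [Field K] {A : Type u} [Ring A] [Algebra K A]

section

variable (M : Type u) [AddCommGroup M] [Module K M] [Module A M] [IsScalarTower K A M]
  (N : Type u) [AddCommGroup N] [Module K N] [Module Aᵐᵒᵖ N] [IsScalarTower K Aᵐᵒᵖ N]

/-- The restriction of `M ⊗_K N` to a left module. -/
def leftResOuterEquiv :
    M ⊗[K] N ≃ₗ[A] (leftRes K A).obj (ModuleCat.of (Env K A) (Outer K A M N)) :=
  { AddEquiv.refl (M ⊗[K] N) with
    map_smul' := fun a t => by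
      induction t using TensorProduct.induction_on with
      | zero =>
        rw [smul_zero]
        exact (smul_zero (M := Env K A) (A := Outer K A M N)
          (a ⊗ₜ[K] (1 : Aᵐᵒᵖ))).symm
      | tmul m n =>
        change (a • m) ⊗ₜ[K] n = (a • m) ⊗ₜ[K] ((1 : Aᵐᵒᵖ) • n)
        rw [one_smul]
      | add s t hs ht =>
        rw [smul_add]
        exact (congrArg₂ (· + ·) hs ht).trans (smul_add (M := Env K A)
          (A := Outer K A M N) (a ⊗ₜ[K] (1 : Aᵐᵒᵖ)) s t).symm }

/-- The restriction of `M ⊗_K N` to a right module. -/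
def rightResOuterEquiv :
    N ⊗[K] M ≃ₗ[Aᵐᵒᵖ] (rightRes K A).obj (ModuleCat.of (Env K A) (Outer K A M N)) :=
  -- The factors are exchanged because the standard module structure on a tensor product acts
  -- through the left factor.
  { (TensorProduct.comm K N M).toAddEquiv with
    map_smul' := fun a t => by
      induction t using TensorProduct.induction_on with
      | zero =>
        rw [smul_zero]
        exact (map_zero (TensorProduct.comm K N M)).trans
          (smul_zero (M := Env K A) (A := Outer K A M N) ((1 : A) ⊗ₜ[K] a)).symm
      | tmul m n =>
        change n ⊗ₜ[K] (a • m) = ((1 : A) • n) ⊗ₜ[K] (a • m)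
        rw [one_smul]
      | add s t hs ht =>
        rw [smul_add]
        exact (map_add (TensorProduct.comm K N M) _ _).trans
          ((congrArg₂ (· + ·) hs ht).trans ((smul_add (M := Env K A)
          (A := Outer K A M N) ((1 : A) ⊗ₜ[K] a) (TensorProduct.comm K N M s)
            (TensorProduct.comm K N M t)).symm.trans
            (congrArg (fun z : Outer K A M N => ((1 : A) ⊗ₜ[K] a : Env K A) • z)
              (map_add (TensorProduct.comm K N M) s t).symm))) }

variable (K A)

/-- The restriction of the regular bimodule to a left module. -/
def leftResRegularEquiv : A ≃ₗ[A] (leftRes K A).obj (regularBimod K A) :=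
  { AddEquiv.refl A with
    map_smul' := fun a x => by
      change a * x = a * (x * 1)
      rw [mul_one] }

/-- The restriction of the regular bimodule to a right module. -/
def rightResRegularEquiv : A ≃ₗ[Aᵐᵒᵖ] (rightRes K A).obj (regularBimod K A) :=
  { AddEquiv.refl A with
    map_smul' := fun a x => by
      change x * a.unop = 1 * (x * a.unop)
      rw [one_mul] }

end

lemma finite_projective_of_linearEquiv {R : Type u} [Ring R] {M N : Type u} [AddCommMonoid M]
    [Module R M] [AddCommMonoid N] [Module R N] (e : M ≃ₗ[R] N)
    (h : Module.Finite R M ∧ Module.Projective R M) :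
    Module.Finite R N ∧ Module.Projective R N := by
  obtain ⟨h₁, h₂⟩ := h
  exact ⟨Module.Finite.equiv e, Module.Projective.of_equiv e⟩

/-- A complex with two terms, both finitely generated projective over `R`, is perfect over `R`. -/
lemma isPerfect_mapHomologicalComplex_double {R S : Type u} [Ring R] [Ring S]
    (G : ModuleCat.{u} S ⥤ ModuleCat.{u} R) [G.Additive] {X₀ X₁ : ModuleCat.{u} S} (f : X₀ ⟶ X₁)
    {a b : ℤ} (hab : (ComplexShape.up ℤ).Rel a b)
    (h₀ : Module.Finite R (G.obj X₀) ∧ Module.Projective R (G.obj X₀))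
    (h₁ : Module.Finite R (G.obj X₁) ∧ Module.Projective R (G.obj X₁)) :
    IsBounded (HomologicalComplex.double f hab) ∧
    (∀ k, Module.Finite R (G.obj ((HomologicalComplex.double f hab).X k)) ∧
      Module.Projective R (G.obj ((HomologicalComplex.double f hab).X k))) ∧
    IsPerfect ((G.mapHomologicalComplex (ComplexShape.up ℤ)).obj
      (HomologicalComplex.double f hab)) := by
  have hab' : a + 1 = b := hab
  have hz : ∀ k, k ≠ a → k ≠ b → Limits.IsZero ((HomologicalComplex.double f hab).X k) :=
    fun k => HomologicalComplex.isZero_double_X f hab k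
  have hX : ∀ k, Module.Finite R (G.obj ((HomologicalComplex.double f hab).X k)) ∧
      Module.Projective R (G.obj ((HomologicalComplex.double f hab).X k)) := by
    intro k
    by_cases ha : k = a
    · subst ha
      exact finite_projective_of_linearEquiv
        (G.mapIso (HomologicalComplex.doubleXIso₀ f hab)).symm.toLinearEquiv h₀
    by_cases hb : k = b
    · subst hb
      exact finite_projective_of_linearEquiv
        (G.mapIso (HomologicalComplex.doubleXIso₁ f hab (Ne.symm ha))).symm.toLinearEquiv h₁
    · have := ModuleCat.subsingleton_of_isZero (G.map_isZero (hz k ha hb))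
      exact ⟨inferInstance, inferInstance⟩
  -- The restricted complex is already bounded with finitely generated projective terms, so it
  -- serves as its own perfect model.
  refine ⟨⟨a, b, ?_, ?_⟩, hX, _, ⟨a, b, ?_, ?_⟩, hX, DerivedIso.refl _⟩
  · rw [CochainComplex.isStrictlyGE_iff]
    exact fun k hk => hz k (by omega) (by omega)
  · rw [CochainComplex.isStrictlyLE_iff]
    exact fun k hk => hz k (by omega) (by omega)
  · rw [CochainComplex.isStrictlyGE_iff]
    exact fun k hk => G.map_isZero (hz k (by omega) (by omega))
  · rw [CochainComplex.isStrictlyLE_iff]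
    exact fun k hk => G.map_isZero (hz k (by omega) (by omega))

variable (A) in
/-- Right multiplication identifies `A` with `Aᵒᵖ` as a right module. -/
def opRightEquiv : Aᵐᵒᵖ ≃ₗ[Aᵐᵒᵖ] A :=
  { MulOpposite.opAddEquiv.symm with map_smul' := fun _ _ => rfl }

end Projective

/-! ### Projectivity of `P_i`, `_iP` and `P_i ⊗ _iP`. -/

section NakayamaProjective

variable (K : Type u) [Field K] {n : ℕ} [NeZero n] (i : ZMod n)

instance : Module.Finite K (leftP K n i) :=
  Module.Finite.of_injective ((leftP K n i).subtype.restrictScalars K) Subtype.val_injective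

instance : Module.Finite K (rightP K n i) :=
  Module.Finite.of_injective ((rightP K n i).subtype.restrictScalars K) Subtype.val_injective

/-- Right multiplication by the idempotent `(i)` retracts `A` onto `P_i`. -/
instance : Module.Projective (Nakayama K n n) (leftP K n i) :=
  Module.Projective.of_split (leftP K n i).subtype
    (LinearMap.toSpanSingleton (Nakayama K n n) (leftP K n i) (idemLeft K i))
    (LinearMap.ext fun x => Subtype.ext (mul_idem_of_mem K x.2))

instance : Module.Projective (Nakayama K n n)ᵐᵒᵖ (rightP K n i) :=
  Module.Projective.of_split ((opRightEquiv _).symm.toLinearMap ∘ₗ (rightP K n i).subtype)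
    (LinearMap.toSpanSingleton (Nakayama K n n)ᵐᵒᵖ (rightP K n i) (idemRight K i))
    (LinearMap.ext fun x => Subtype.ext (idem_mul_of_mem K x.2))

lemma leftRes_PP_finite_projective :
    Module.Finite (Nakayama K n n) ((leftRes K (Nakayama K n n)).obj (PP K n i)) ∧
      Module.Projective (Nakayama K n n) ((leftRes K (Nakayama K n n)).obj (PP K n i)) :=
  finite_projective_of_linearEquiv
    (leftResOuterEquiv (K := K) (A := Nakayama K n n) (leftP K n i) (rightP K n i))
    ⟨Module.Finite.of_restrictScalars_finite K _ _, inferInstance⟩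

lemma rightRes_PP_finite_projective :
    Module.Finite (Nakayama K n n)ᵐᵒᵖ ((rightRes K (Nakayama K n n)).obj (PP K n i)) ∧
      Module.Projective (Nakayama K n n)ᵐᵒᵖ ((rightRes K (Nakayama K n n)).obj (PP K n i)) :=
  finite_projective_of_linearEquiv
    (rightResOuterEquiv (K := K) (A := Nakayama K n n) (leftP K n i) (rightP K n i))
    ⟨Module.Finite.of_restrictScalars_finite K _ _, inferInstance⟩

end NakayamaProjective

/-! ### Biperfectness and the tilting property. -/

section Tilting

lemma leftRes_regular_finite_projective (K : Type u) [Field K] (A : Type u) [Ring A] [Algebra K A] :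
    Module.Finite A ((leftRes K A).obj (regularBimod K A)) ∧
      Module.Projective A ((leftRes K A).obj (regularBimod K A)) :=
  finite_projective_of_linearEquiv (leftResRegularEquiv K A) ⟨inferInstance, inferInstance⟩

lemma rightRes_regular_finite_projective (K : Type u) [Field K] (A : Type u) [Ring A]
    [Algebra K A] :
    Module.Finite Aᵐᵒᵖ ((rightRes K A).obj (regularBimod K A)) ∧
      Module.Projective Aᵐᵒᵖ ((rightRes K A).obj (regularBimod K A)) :=
  finite_projective_of_linearEquiv ((opRightEquiv A).trans (rightResRegularEquiv K A))
    ⟨inferInstance, inferInstance⟩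

/-- The terms are projective as right modules, so the complex is its own resolution (through the
identity map), and a homotopy equivalence for the underived tensor product suffices for the derived
one. -/
lemma isBiperfect_double {K : Type u} [Field K] {A : Type u} [Ring A] [Algebra K A]
    {X₀ X₁ : BimodCat K A} (f : X₀ ⟶ X₁) {a b : ℤ} (hab : (ComplexShape.up ℤ).Rel a b)
    (hl₀ : Module.Finite A ((leftRes K A).obj X₀) ∧ Module.Projective A ((leftRes K A).obj X₀))
    (hl₁ : Module.Finite A ((leftRes K A).obj X₁) ∧ Module.Projective A ((leftRes K A).obj X₁))
    (hr₀ : Module.Finite Aᵐᵒᵖ ((rightRes K A).obj X₀) ∧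
      Module.Projective Aᵐᵒᵖ ((rightRes K A).obj X₀))
    (hr₁ : Module.Finite Aᵐᵒᵖ ((rightRes K A).obj X₁) ∧
      Module.Projective Aᵐᵒᵖ ((rightRes K A).obj X₁)) :
    IsBiperfect (HomologicalComplex.double f hab) ∧
      ∀ Y Z : BimodCpx K A,
        Nonempty (HomotopyEquiv (tensorCpx (HomologicalComplex.double f hab) Y) Z) →
        DerivedTensorIso (HomologicalComplex.double f hab) Y Z := by
  obtain ⟨hb, -, hl⟩ := isPerfect_mapHomologicalComplex_double (leftRes K A) f hab hl₀ hl₁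
  obtain ⟨-, hp, hr⟩ := isPerfect_mapHomologicalComplex_double (rightRes K A) f hab hr₀ hr₁
  refine ⟨⟨hb, hl, hr⟩, fun Y Z h => ⟨_, 𝟙 _, inferInstance, ?_, fun k => (hp k).2,
    DerivedIso.of_homotopyEquiv h⟩⟩
  obtain ⟨_, b', _, hb'⟩ := hb
  exact ⟨b', hb'⟩

variable (K : Type u) [Field K] {n : ℕ} [NeZero n] (i : ZMod n)

lemma areInverseTilting_F_F' : AreInverseTilting (F K i) (F' K i) := by
  obtain ⟨h₁, h₂⟩ := isBiperfect_double (alpha K n i)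
    (show (ComplexShape.up ℤ).Rel (-1) 0 from neg_add_cancel (1 : ℤ))
    (leftRes_PP_finite_projective K i) (leftRes_regular_finite_projective K _)
    (rightRes_PP_finite_projective K i) (rightRes_regular_finite_projective K _)
  obtain ⟨h₃, h₄⟩ := isBiperfect_double (beta K i)
    (show (ComplexShape.up ℤ).Rel 0 1 from zero_add (1 : ℤ))
    (leftRes_regular_finite_projective K _) (leftRes_PP_finite_projective K i)
    (rightRes_regular_finite_projective K _) (rightRes_PP_finite_projective K i)
  exact ⟨h₁, h₃, h₂ _ _ (nonempty_homotopyEquiv_tensor_F_F' K i),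
    h₄ _ _ (nonempty_homotopyEquiv_tensor_F'_F K i)⟩

lemma AreInverseTilting.symm {A : Type u} [Ring A] [Algebra K A] {X Y : BimodCpx K A}
    (h : AreInverseTilting X Y) : AreInverseTilting Y X :=
  ⟨h.right, h.left, h.tensor_iso', h.tensor_iso⟩

end Tilting

end

end NakayamaTilting

theorem mainTheorem9 (K : Type u) [Field K] (n : ℕ) [NeZero n] (i : ZMod n) :
    NakayamaTilting.AreInverseTilting (NakayamaTilting.F K i) (NakayamaTilting.F' K i) ∧
    NakayamaTilting.isoClass (NakayamaTilting.F K i) ∈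
      NakayamaTilting.TrPic K (NakayamaTilting.Nakayama K n n) ∧
    NakayamaTilting.isoClass (NakayamaTilting.F' K i) ∈
      NakayamaTilting.TrPic K (NakayamaTilting.Nakayama K n n) := by
  have h := NakayamaTilting.areInverseTilting_F_F' K i
  exact ⟨h, ⟨_, ⟨_, h⟩, rfl⟩, ⟨_, ⟨_, h.symm⟩, rfl⟩⟩
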